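/- Let $\mathbb{K}$ be $\mathbb{C}$ or $\mathbb{R}$, let $\alpha,\beta\in\mathbb{K}$, and consider Fordy's equation $$u_t=F,\qquad F=u_5+(4\alpha-6\beta)u_1u_2+(8\alpha-2\beta)u_0u_3-20\alpha\beta u_0^2u_1,$$ where $u=u(x,t)$ is $\mathbb{K}$-valued, $u_0=u$ and $u_k=\partial^k u/\partial x^k$. Its infinite prolongation $\mathcal{E}=\mathbb{K}^\infty$ is the space with the coordinates $x,t,u_0,u_1,u_2,\dots$, with the total derivative operators $$D_x=\frac{\partial}{\partial x}+\sum_{k\ge0}u_{k+1}\frac{\partial}{\partial u_k},\qquad D_t=\frac{\partial}{\partial t}+\sum_{k\ge0}D_x^k(F)\frac{\partial}{\partial u_k}.$$ Let $a=(x=x_a,\,t=t_a,\,u_k=a_k)$ be any point of $\mathcal{E}$. Let $\mathbb{F}^0(\mathcal{E},a)$ be the Lie algebra over $\mathbb{K}$ given by the generators $\mathbf{A}^{l_1,l_2}_{i}$ and $\mathbf{B}^{l_1,l_2}_{j_0j_1j_2j_3j_4}$ (all indices are nonnegative integers), the relations $$\mathbf{A}^{l_1,l_2}_{0}=0,\qquad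 \mathbf{B}^{0,l_2}_{00000}=0\qquad\text{for all } l_1,l_2\ge0,$$ and the relations obtained by equating to zero all coefficients of the formal power series $D_x(\mathbf{B})-D_t(\mathbf{A})+[\mathbf{A},\mathbf{B}]$ in $x-x_a$, $t-t_a$, $u_k-a_k$, where $$\mathbf{A}=\sum (x-x_a)^{l_1}(t-t_a)^{l_2}(u_0-a_0)^{i}\,\mathbf{A}^{l_1,l_2}_{i},\qquad \mathbf{B}=\sum (x-x_a)^{l_1}(t-t_a)^{l_2}(u_0-a_0)^{j_0}\cdots(u_4-a_4)^{j_4}\,\mathbf{B}^{l_1,l_2}_{j_0j_1j_2j_3j_4}.$$ Then the following holds. 1. If $\alpha+\beta\ne0$, $6\alpha+\beta\ne0$, $16\alpha+\beta\ne0$ and $\alpha\neq0$, then $\mathbb{F}^0(\mathcal{E},a)$ is isomorphic to the direct sum of $\mathfrak{sl}_2(\mathbb{K})$ and an abelian Lie algebra of dimension $\le3$. 2. If $\alpha=0$ and $\beta\ne0$, then the Lie algebra $\mathbb{F}^0(\mathcal{E},a)$ is nilpotent and of dimension $\le6$. -/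

import Mathlib

universe u

noncomputable section

namespace EvolutionEquation

open Finset

/-- The coordinates `x`, `t`, `u_k` (`k = 0, 1, 2, …`) on the infinite prolongation of a scalar
evolution equation `u_t = F`, where `u_k` stands for the `k`-th derivative of `u` in `x`. -/
inductive Coord : Type
  | x : Coord
  | t : Coord
  | u (k : ℕ) : Coord
  deriving DecidableEq

variable (𝕜 : Type*) [Field 𝕜]

/-- The total derivative operator `D_x = ∂/∂x + ∑ₖ u_{k+1} ∂/∂u_k` on polynomial functions. -/
def totalDx : Derivation 𝕜 (MvPolynomial Coord 𝕜) (MvPolynomial Coord 𝕜) :=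
  MvPolynomial.mkDerivation 𝕜 fun v =>
    match v with
    | .x => 1
    | .t => 0
    | .u k => MvPolynomial.X (.u (k + 1))

variable {𝕜}

/-- The total derivative operator `D_t = ∂/∂t + ∑ₖ D_x^k(F) ∂/∂u_k` of the evolution equation
`u_t = F`, on polynomial functions. -/
def totalDt (F : MvPolynomial Coord 𝕜) :
    Derivation 𝕜 (MvPolynomial Coord 𝕜) (MvPolynomial Coord 𝕜) :=
  MvPolynomial.mkDerivation 𝕜 fun v =>
    match v with
    | .x => 0
    | .t => 1
    | .u k => (totalDx 𝕜)^[k] F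

/-- The Taylor expansion of `g` at the point `a`: the variable `X v` of `taylorAt a g` stands for
the difference of the coordinate `v` and its value `a v`. -/
def taylorAt (a : Coord → 𝕜) (g : MvPolynomial Coord 𝕜) : MvPolynomial Coord 𝕜 :=
  MvPolynomial.aeval (fun v => MvPolynomial.X v + MvPolynomial.C (a v)) g

/-- Formal power series at a point `a` with coefficients in `L`: the value at `m` is the
coefficient of the monomial `∏ᵥ (v - a v) ^ (m v)`. -/
abbrev FormalSeries (L : Type*) : Type _ := (Coord →₀ ℕ) → L

section Series

variable {L : Type*} [LieRing L] [LieAlgebra 𝕜 L]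

/-- The formal partial derivative with respect to the coordinate `v`. -/
def partialDeriv (v : Coord) (f : FormalSeries L) : FormalSeries L :=
  fun m => (m v + 1) • f (m + Finsupp.single v 1)

/-- The product of a polynomial function, expanded at `a`, and a formal series at `a`. -/
def polyMul (a : Coord → 𝕜) (g : MvPolynomial Coord 𝕜) (f : FormalSeries L) : FormalSeries L :=
  fun m => ∑ ij ∈ antidiagonal m, MvPolynomial.coeff ij.1 (taylorAt a g) • f ij.2

/-- The finite set of coordinates `x, t, u_0, …, u_q`. -/
def coordsUpTo (q : ℕ) : Finset Coord :=
  {Coord.x, Coord.t} ∪ (Finset.range (q + 1)).image Coord.u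

/-- The action `∑ᵥ D(v) ∂/∂v` of the vector field `D` on a formal series at `a` which depends on
the coordinates `x, t, u_0, …, u_q` only. -/
def applyField (a : Coord → 𝕜)
    (D : Derivation 𝕜 (MvPolynomial Coord 𝕜) (MvPolynomial Coord 𝕜)) (q : ℕ)
    (f : FormalSeries L) : FormalSeries L :=
  fun m => ∑ v ∈ coordsUpTo q, polyMul a (D (MvPolynomial.X v)) (partialDeriv v f) m

/-- The bracket of formal series with coefficients in a Lie algebra. -/
def seriesBracket (f g : FormalSeries L) : FormalSeries L :=
  fun m => ∑ ij ∈ antidiagonal m, ⁅f ij.1, g ij.2⁆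

/-- The left-hand side `D_x(B) - D_t(A) + [A, B]` of the zero-curvature equation, where
`A = A(x, t, u_0, …, u_p)` and `B = B(x, t, u_0, …, u_q)`. -/
def zeroCurvature (F : MvPolynomial Coord 𝕜) (a : Coord → 𝕜) (p q : ℕ)
    (A B : FormalSeries L) : FormalSeries L :=
  fun m => applyField a (totalDx 𝕜) q B m - applyField a (totalDt F) p A m + seriesBracket A B m

end Series

/-- Symbols for the coefficients of the two formal series `A` and `B`. -/
inductive Gen : Type
  | coeffA (m : Coord →₀ ℕ) : Gen
  | coeffB (m : Coord →₀ ℕ) : Gen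

/-- The series `A` whose coefficients are free generators. -/
def genericA (𝕜 : Type*) [Field 𝕜] : FormalSeries (FreeLieAlgebra 𝕜 Gen) :=
  fun m => FreeLieAlgebra.of 𝕜 (Gen.coeffA m)

/-- The series `B` whose coefficients are free generators. -/
def genericB (𝕜 : Type*) [Field 𝕜] : FormalSeries (FreeLieAlgebra 𝕜 Gen) :=
  fun m => FreeLieAlgebra.of 𝕜 (Gen.coeffB m)

/-- The monomial `m` involves none of the `u_k` with `k > q`. -/
def DependsUpTo (q : ℕ) (m : Coord →₀ ℕ) : Prop := ∀ k, q < k → m (.u k) = 0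

/-- The monomial `m` involves none of the `u_k`. -/
def NoU (m : Coord →₀ ℕ) : Prop := ∀ k, m (.u k) = 0

/-- The last `u_k` in the monomial `m` has `k ≥ 1` and exponent `1`. -/
def LastExponentOne (m : Coord →₀ ℕ) : Prop :=
  ∃ r, 1 ≤ r ∧ m (.u r) = 1 ∧ ∀ k, r < k → m (.u k) = 0

/-- The defining relations of `𝔽^p(E, a)` for the equation `u_t = F(x, t, u_0, …, u_n)`. -/
inductive Relation (F : MvPolynomial Coord 𝕜) (n p : ℕ) (a : Coord → 𝕜) :
    FreeLieAlgebra 𝕜 Gen → Prop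
  /-- `A = A(x, t, u_0, …, u_p)` -/
  | orderA (m : Coord →₀ ℕ) : ¬ DependsUpTo p m → Relation F n p a (genericA 𝕜 m)
  /-- `B = B(x, t, u_0, …, u_{p+n-1})` -/
  | orderB (m : Coord →₀ ℕ) : ¬ DependsUpTo (p + n - 1) m → Relation F n p a (genericB 𝕜 m)
  /-- `A = 0` on `u_k = a_k`, `k ≥ 0` -/
  | normA (m : Coord →₀ ℕ) : NoU m → Relation F n p a (genericA 𝕜 m)
  /-- `∂A/∂u_s = 0` on `u_k = a_k`, `k ≥ s`, for all `s ≥ 1` -/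
  | normA' (m : Coord →₀ ℕ) : LastExponentOne m → Relation F n p a (genericA 𝕜 m)
  /-- `B = 0` on `x = x_a`, `u_k = a_k`, `k ≥ 0` -/
  | normB (m : Coord →₀ ℕ) : m .x = 0 → NoU m → Relation F n p a (genericB 𝕜 m)
  /-- `D_x(B) - D_t(A) + [A, B] = 0` -/
  | zcr (m : Coord →₀ ℕ) :
      Relation F n p a (zeroCurvature F a p (p + n - 1) (genericA 𝕜) (genericB 𝕜) m)

/-- The Lie algebra `𝔽^p(E, a)` of the evolution equation `u_t = F(x, t, u_0, …, u_n)`, `n ≥ 1`,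
at the point `a` of its infinite prolongation `E`, by generators and relations. -/
abbrev FAlgebra (F : MvPolynomial Coord 𝕜) (n p : ℕ) (a : Coord → 𝕜) : Type _ :=
  FreeLieAlgebra 𝕜 Gen ⧸
    LieSubmodule.lieSpan 𝕜 (FreeLieAlgebra 𝕜 Gen) {r | Relation F n p a r}

/-- The right-hand side
`u_5 + (4α - 6β) u_1 u_2 + (8α - 2β) u_0 u_3 - 20 α β u_0² u_1` of Fordy's equation. -/
def fordyRHS (α β : 𝕜) : MvPolynomial Coord 𝕜 :=
  MvPolynomial.X (.u 5)
    + MvPolynomial.C (4 * α - 6 * β) * MvPolynomial.X (.u 1) * MvPolynomial.X (.u 2)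
    + MvPolynomial.C (8 * α - 2 * β) * MvPolynomial.X (.u 0) * MvPolynomial.X (.u 3)
    - MvPolynomial.C (20 * α * β) * MvPolynomial.X (.u 0) ^ 2 * MvPolynomial.X (.u 1)

end EvolutionEquation

end

/-! Write `A'` for `∂A/∂u_0` and `∇ = D_x + ad A`, so that the zero-curvature equation reads `∇B =
D_t A`. Differentiating it in `u_5, …, u_1` expresses every `∂B/∂u_k` through `A'`. Equality of
mixed derivatives of `B` then forces `(6α + β) A'' = 0`. The normalization of `A` gives `A = (u_0 -
a_0) P(x,t)`, and `B` equals an explicit differential expression in `P` plus a term `b(x,t)`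
(`FordyZCR.exists_decomposition`). What remains is a finite list of relations between `P`, its
`x`-derivatives and `b` (`fordyZCR_iff`).

The core is `fordy_relations`. Put `s = a_0`, `K = [P, P_x] + 4αP` and `R = P_xxx + 8αs P_x`. The
series `K` is independent of `x` and commutes with `P` and all its `x`-derivatives. Applying the
derivation `∂_t + ad b` to `[P, K] = 0` leads to `(α + β)(16α + β) R = 0` once `6α + β ≠ 0`; hence
`R = 0`.

Now `x`-differentiation preserves the span of `P, P_x, P_xx`. The normalization of `B` produces a
constant `J` with `P_t = [J, P]`, and makes `K` constant. So all coefficients of `A` and `B` lie in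
the span of the values of `P, P_x, P_xx, K` at the point (`FordyZCR.exists_fordyBasis`). These four
elements, which need not be independent, satisfy the brackets of `FordyBasis`, with `K` central, and
they span the whole algebra.

If `α = 0`, the only possibly nonzero bracket is `[P, P_x] = K`: the algebra is nilpotent of
dimension at most 4. If `α ≠ 0`, the relations modulo `K` are those of `𝔰𝔩₂`. To see that nothing
more collapses, an explicit solution with values in `𝔰𝔩₂` is built from exponentials
(`exists_fordyZCR`). It induces a surjection onto `𝔰𝔩₂`, which splits with kernel spanned by `K`
(`FordyBasis.exists_equiv`). -/

noncomputable section

namespace EvolutionEquation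

open MvPolynomial Finset.HasAntidiagonal
open Finset (sum_congr sum_add_distrib sum_eq_zero smul_sum sum_smul)

/-! ### Reindexing of convolution sums. -/

section Antidiagonal

variable {M : Type*} [AddCommMonoid M]

theorem sum_antidiagonal_assoc {ι : Type*} [AddCommMonoid ι] [Finset.HasAntidiagonal ι]
    (F : ι → ι → ι → M) (n : ι) :
    ∑ p ∈ antidiagonal n, ∑ q ∈ antidiagonal p.1, F q.1 q.2 p.2
      = ∑ p ∈ antidiagonal n, ∑ q ∈ antidiagonal p.2, F p.1 q.1 q.2 := by
  simp only [Finset.sum_sigma']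
  apply Finset.sum_nbij' (fun ⟨⟨_i, j⟩, ⟨k, l⟩⟩ ↦ ⟨(k, l + j), (l, j)⟩)
    (fun ⟨⟨i, _j⟩, ⟨k, l⟩⟩ ↦ ⟨(i + k, l), (i, k)⟩) <;> simp +contextual [add_assoc]
  all_goals grind

theorem sum_antidiagonal_left_comm {ι : Type*} [AddCommMonoid ι] [Finset.HasAntidiagonal ι]
    (F : ι → ι → ι → M) (n : ι) :
    ∑ p ∈ antidiagonal n, ∑ q ∈ antidiagonal p.2, F p.1 q.1 q.2
      = ∑ p ∈ antidiagonal n, ∑ q ∈ antidiagonal p.2, F q.1 p.1 q.2 := by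
  simp only [Finset.sum_sigma']
  apply Finset.sum_nbij' (fun ⟨⟨i, _j⟩, ⟨k, l⟩⟩ ↦ ⟨(k, i + l), (i, l)⟩)
    (fun ⟨⟨i, _j⟩, ⟨k, l⟩⟩ ↦ ⟨(k, i + l), (i, l)⟩) <;>
    simp +contextual [add_left_comm]

theorem sum_antidiagonal_add_single_left {σ : Type*} [DecidableEq σ]
    (F : (σ →₀ ℕ) → (σ →₀ ℕ) → M) (m : σ →₀ ℕ) (v : σ) :
    ∑ p ∈ antidiagonal (m + Finsupp.single v 1), (p.1 : σ →₀ ℕ) v • F p.1 p.2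
      = ∑ p ∈ antidiagonal m, ((p.1 : σ →₀ ℕ) v + 1) • F (p.1 + Finsupp.single v 1) p.2 := by
  symm
  apply Finset.sum_of_injOn (fun p => (p.1 + Finsupp.single v 1, p.2))
  · rintro ⟨i, j⟩ - ⟨k, l⟩ - h
    simpa using h
  · rintro ⟨i, j⟩ h
    simp only [Finset.mem_coe, mem_antidiagonal] at h ⊢
    rw [← h, add_right_comm]
  · rintro ⟨i, j⟩ h h'
    simp only [mem_antidiagonal] at h
    by_cases hv : i v = 0
    · simp [hv]
    · exfalso
      apply h'
      have hle : Finsupp.single v 1 ≤ i := by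
        rw [Finsupp.single_le_iff]; omega
      refine ⟨(i - Finsupp.single v 1, j), ?_, ?_⟩
      · simp only [Finset.mem_coe, mem_antidiagonal]
        apply add_right_cancel (b := Finsupp.single v 1)
        rw [add_right_comm, tsub_add_cancel_of_le hle, h]
      · simp [tsub_add_cancel_of_le hle]
  · rintro ⟨i, j⟩ -
    simp

theorem sum_antidiagonal_add_single_right {σ : Type*} [DecidableEq σ]
    (F : (σ →₀ ℕ) → (σ →₀ ℕ) → M) (m : σ →₀ ℕ) (v : σ) :
    ∑ p ∈ antidiagonal (m + Finsupp.single v 1), (p.2 : σ →₀ ℕ) v • F p.1 p.2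
      = ∑ p ∈ antidiagonal m, ((p.2 : σ →₀ ℕ) v + 1) • F p.1 (p.2 + Finsupp.single v 1) := by
  have swap (G : (σ →₀ ℕ) → (σ →₀ ℕ) → M) (n : σ →₀ ℕ) :
      ∑ p ∈ antidiagonal n, G p.1 p.2 = ∑ p ∈ antidiagonal n, G p.2 p.1 := by
    conv_lhs => rw [← map_swap_antidiagonal, Finset.sum_map]
    rfl
  rw [swap (fun i j => j v • F i j), swap (fun i j => (j v + 1) • F i (j + Finsupp.single v 1))]
  exact sum_antidiagonal_add_single_left (fun i j => F j i) m v

/-- The Leibniz rule for any biadditive convolution, on coefficients: the exponent of `v` in the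
product is the sum of the exponents in the factors. It serves both the bracket and the action of
polynomials. -/
theorem sum_antidiagonal_leibniz {σ : Type*} [DecidableEq σ]
    (F : (σ →₀ ℕ) → (σ →₀ ℕ) → M) (m : σ →₀ ℕ) (v : σ) :
    (m v + 1) • ∑ p ∈ antidiagonal (m + Finsupp.single v 1), F p.1 p.2
      = ∑ p ∈ antidiagonal m, ((p.1 : σ →₀ ℕ) v + 1) • F (p.1 + Finsupp.single v 1) p.2
        + ∑ p ∈ antidiagonal m, ((p.2 : σ →₀ ℕ) v + 1) • F p.1 (p.2 + Finsupp.single v 1) := by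
  rw [← sum_antidiagonal_add_single_left, ← sum_antidiagonal_add_single_right,
    ← Finset.sum_add_distrib, Finset.smul_sum]
  refine Finset.sum_congr rfl fun p hp => ?_
  rw [mem_antidiagonal] at hp
  rw [← add_smul, ← Finsupp.add_apply, hp]
  simp

end Antidiagonal

/-! ### The differential Lie algebra of formal series over the polynomial ring. -/

/-- Formal power series with coefficients in a Lie algebra, as a Lie algebra over the ring of
polynomials. -/
def LieSeries (L : Type*) : Type _ := FormalSeries L

namespace LieSeries

/-- The coefficients of a series. -/
def coeff {L : Type*} (f : LieSeries L) : FormalSeries L := f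

/-- The series with given coefficients. -/
def mk {L : Type*} (f : FormalSeries L) : LieSeries L := f

@[simp] theorem coeff_mk {L : Type*} (f : FormalSeries L) : (mk f).coeff = f := rfl

@[ext] theorem ext {L : Type*} {f g : LieSeries L} (h : ∀ m, f.coeff m = g.coeff m) : f = g :=
  funext h

variable {𝕜 : Type*} [Field 𝕜] {L : Type*} [LieRing L] [LieAlgebra 𝕜 L]

instance : AddCommGroup (LieSeries L) := inferInstanceAs (AddCommGroup (FormalSeries L))

instance : Module 𝕜 (LieSeries L) := inferInstanceAs (Module 𝕜 (FormalSeries L))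

@[simp] theorem coeff_add (f g : LieSeries L) (m) : (f + g).coeff m = f.coeff m + g.coeff m := rfl
@[simp] theorem coeff_sub (f g : LieSeries L) (m) : (f - g).coeff m = f.coeff m - g.coeff m := rfl
@[simp] theorem coeff_neg (f : LieSeries L) (m) : (-f).coeff m = -f.coeff m := rfl
@[simp] theorem coeff_zero (m) : (0 : LieSeries L).coeff m = 0 := rfl
@[simp] theorem coeff_smul (r : 𝕜) (f : LieSeries L) (m) : (r • f).coeff m = r • f.coeff m := rfl

/-- This is the convolution bracket; the bare function type already carries the pointwise one, hence
the type synonym. -/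
instance : Bracket (LieSeries L) (LieSeries L) := ⟨fun f g => mk (seriesBracket f.coeff g.coeff)⟩

theorem coeff_lie (f g : LieSeries L) (m) :
    ⁅f, g⁆.coeff m = ∑ p ∈ antidiagonal m, ⁅f.coeff p.1, g.coeff p.2⁆ := rfl

instance : LieRing (LieSeries L) where
  add_lie f g h := by ext m; simp [coeff_lie, sum_add_distrib]
  lie_add f g h := by ext m; simp [coeff_lie, sum_add_distrib]
  lie_self f := by
    ext m
    rw [coeff_lie]
    refine Finset.sum_involution (fun p _ => p.swap) ?_ ?_ ?_ ?_
    · rintro ⟨i, j⟩ -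
      rw [Prod.swap_prod_mk, ← lie_skew, neg_add_cancel]
    · rintro ⟨i, j⟩ - h1 h2
      simp only [Prod.swap_prod_mk, Prod.mk.injEq] at h2
      simp [h2.1] at h1
    · rintro ⟨i, j⟩ h
      simpa [add_comm] using h
    · simp
  leibniz_lie f g h := by
    ext m
    simp only [coeff_add, coeff_lie, lie_sum, sum_lie]
    rw [sum_antidiagonal_assoc (fun i j k => ⁅⁅f.coeff i, g.coeff j⁆, h.coeff k⁆),
      sum_antidiagonal_left_comm (fun i j k => ⁅g.coeff i, ⁅f.coeff j, h.coeff k⁆⁆),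
      ← sum_add_distrib]
    refine sum_congr rfl fun p _ => ?_
    rw [← sum_add_distrib]
    exact sum_congr rfl fun q _ => leibniz_lie _ _ _

instance : LieAlgebra 𝕜 (LieSeries L) where
  lie_smul r f g := by ext m; simp [coeff_lie, smul_sum]

/-- Polynomials act in shifted coordinates: `X v` stands for `v - a v`, so the coordinate `u_k`
itself acts as `uAt a k`. -/
instance : SMul (MvPolynomial Coord 𝕜) (LieSeries L) :=
  ⟨fun g f => mk fun m => ∑ p ∈ antidiagonal m, MvPolynomial.coeff p.1 g • f.coeff p.2⟩

theorem coeff_poly_smul (g : MvPolynomial Coord 𝕜) (f : LieSeries L) (m) :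
    (g • f).coeff m = ∑ p ∈ antidiagonal m, MvPolynomial.coeff p.1 g • f.coeff p.2 := rfl

theorem C_smul (r : 𝕜) (f : LieSeries L) : (C r : MvPolynomial Coord 𝕜) • f = r • f := by
  ext m
  rw [coeff_poly_smul, Finset.sum_eq_single (0, m)]
  · simp
  · rintro ⟨i, j⟩ h h'
    simp only [mem_antidiagonal] at h
    rw [coeff_C, if_neg, zero_smul]
    rintro rfl
    simp at h
    exact h' (by rw [h])
  · simp

instance : Module (MvPolynomial Coord 𝕜) (LieSeries L) where
  one_smul f := by rw [← C_1, C_smul, one_smul]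
  mul_smul g h f := by
    ext m
    simp only [coeff_poly_smul, coeff_mul, sum_smul, smul_sum, mul_smul]
    exact sum_antidiagonal_assoc
      (fun i j k => MvPolynomial.coeff i g • MvPolynomial.coeff j h • f.coeff k) m
  smul_zero g := by ext m; simp [coeff_poly_smul]
  smul_add g f h := by ext m; simp [coeff_poly_smul, sum_add_distrib]
  add_smul g h f := by ext m; simp [coeff_poly_smul, sum_add_distrib, add_smul]
  zero_smul f := by ext m; simp [coeff_poly_smul]

instance : LieAlgebra (MvPolynomial Coord 𝕜) (LieSeries L) where
  lie_smul g f h := by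
    ext m
    simp only [coeff_poly_smul, coeff_lie, lie_sum, smul_sum, lie_smul]
    exact sum_antidiagonal_left_comm
      (fun i j k => MvPolynomial.coeff j g • ⁅f.coeff i, h.coeff k⁆) m

theorem coeff_X_smul_of_eq_zero {v : Coord} {m : Coord →₀ ℕ} (hm : m v = 0) (f : LieSeries L) :
    ((X v : MvPolynomial Coord 𝕜) • f).coeff m = 0 := by
  rw [coeff_poly_smul]
  refine sum_eq_zero fun p hp => ?_
  rw [mem_antidiagonal] at hp
  have h : ¬ Finsupp.single v 1 = p.1 := by
    intro h
    rw [← hp, ← h] at hm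
    simp at hm
  rw [MvPolynomial.coeff_X, if_neg h, zero_smul]

/-- The formal partial derivative of a series. -/
def pd (v : Coord) : LieSeries L →+ LieSeries L where
  toFun f := mk (partialDeriv v f.coeff)
  map_zero' := by ext m; simp [partialDeriv]
  map_add' f g := by ext m; simp [partialDeriv]

theorem coeff_pd (v : Coord) (f : LieSeries L) (m) :
    (pd v f).coeff m = (m v + 1) • f.coeff (m + Finsupp.single v 1) := rfl

theorem pd_lie (v : Coord) (f g : LieSeries L) : pd v ⁅f, g⁆ = ⁅pd v f, g⁆ + ⁅f, pd v g⁆ := by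
  ext m
  simp only [coeff_pd, coeff_lie, coeff_add]
  rw [sum_antidiagonal_leibniz (fun i j => ⁅f.coeff i, g.coeff j⁆)]
  simp

theorem pd_comm (v w : Coord) (f : LieSeries L) : pd v (pd w f) = pd w (pd v f) := by
  ext m
  simp only [coeff_pd]
  by_cases h : v = w
  · rw [h]
  · simp only [smul_smul, Finsupp.add_apply, Finsupp.single_apply, h, Ne.symm h, if_false,
      add_zero, mul_comm, add_right_comm m]

theorem pd_smul (v : Coord) (r : 𝕜) (f : LieSeries L) : pd v (r • f) = r • pd v f := by
  ext m
  simp only [coeff_pd, coeff_smul]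
  exact smul_comm _ _ _

theorem pd_poly_smul (v : Coord) (g : MvPolynomial Coord 𝕜) (f : LieSeries L) :
    pd v (g • f) = pderiv v g • f + g • pd v f := by
  ext m
  simp only [coeff_pd, coeff_poly_smul, coeff_add]
  rw [sum_antidiagonal_leibniz (fun i j => MvPolynomial.coeff i g • f.coeff j)]
  congr 1
  · refine sum_congr rfl fun p _ => ?_
    rw [← smul_assoc, coeff_pderiv, nsmul_eq_mul, mul_comm]
    simp
  · exact sum_congr rfl fun p _ => smul_comm _ _ _

end LieSeries
end EvolutionEquation

end

/-! ### The zero-curvature equation of Fordy's equation, written out. -/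

noncomputable section

namespace EvolutionEquation

open MvPolynomial LieSeries

section ZeroCurvature

variable {𝕜 : Type*} [Field 𝕜] {L : Type*} [LieRing L] [LieAlgebra 𝕜 L]

/-- The coordinate `u_k`, expanded at the point `a`. -/
def uAt (a : Coord → 𝕜) (k : ℕ) : MvPolynomial Coord 𝕜 := X (.u k) + C (a (.u k))

theorem pderiv_uAt (a : Coord → 𝕜) (j k : ℕ) :
    pderiv (.u j) (uAt a k) = if j = k then 1 else 0 := by
  simp [uAt, pderiv_X, Pi.single_apply, eq_comm]

theorem pderiv_x_uAt (a : Coord → 𝕜) (k : ℕ) : pderiv .x (uAt a k) = 0 := by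
  simp [uAt, pderiv_X]

theorem zeroCurvature_fordy (α β : 𝕜) (a : Coord → 𝕜) (A B : LieSeries L) :
    LieSeries.mk (zeroCurvature (fordyRHS α β) a 0 (0 + 5 - 1) A.coeff B.coeff) =
      pd .x B + uAt a 1 • pd (.u 0) B + uAt a 2 • pd (.u 1) B + uAt a 3 • pd (.u 2) B
        + uAt a 4 • pd (.u 3) B + uAt a 5 • pd (.u 4) B
        - (pd .t A + (uAt a 5 + C (4 * α - 6 * β) * uAt a 1 * uAt a 2
          + C (8 * α - 2 * β) * uAt a 0 * uAt a 3
          - C (20 * α * β) * uAt a 0 ^ 2 * uAt a 1) • pd (.u 0) A) + ⁅A, B⁆ := by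
  have hmul (g : MvPolynomial Coord 𝕜) (v : Coord) (f : LieSeries L) (m) :
      polyMul a g (partialDeriv v f.coeff) m = (taylorAt a g • pd v f).coeff m := rfl
  ext m
  simp only [coeff_mk, zeroCurvature, applyField, hmul]
  have h4 : coordsUpTo (0 + 5 - 1) = {.x, .t, .u 0, .u 1, .u 2, .u 3, .u 4} := by decide
  have h0 : coordsUpTo 0 = {.x, .t, .u 0} := by decide
  have hb : seriesBracket A.coeff B.coeff m = ⁅A, B⁆.coeff m := rfl
  rw [h4, h0, hb]
  have hF : taylorAt a (fordyRHS α β) = uAt a 5 + C (4 * α - 6 * β) * uAt a 1 * uAt a 2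
          + C (8 * α - 2 * β) * uAt a 0 * uAt a 3
          - C (20 * α * β) * uAt a 0 ^ 2 * uAt a 1 := by
    simp only [fordyRHS, taylorAt, map_add, map_sub, map_mul, map_pow, aeval_X, aeval_C,
      algebraMap_eq, uAt]
  have hx (v : Coord) : taylorAt a (totalDx 𝕜 (X v)) =
      match v with
      | .x => 1
      | .t => 0
      | .u k => uAt a (k + 1) := by
    cases v <;> simp [totalDx, taylorAt, mkDerivation_X, uAt]
  have ht (v : Coord) : taylorAt a (totalDt (fordyRHS α β) (X v)) =
      match v with
      | .x => 0
      | .t => 1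
      | .u k => taylorAt a ((totalDx 𝕜)^[k] (fordyRHS α β)) := by
    cases v <;> simp [totalDt, taylorAt, mkDerivation_X]
  simp only [hx, ht]
  rw [← hF]
  simp [Finset.sum_insert]
  abel

end ZeroCurvature

end EvolutionEquation

end

/-! ### The algebraic core: consequences of the relations for `P`. -/

noncomputable section

namespace EvolutionEquation

section Algebra

variable {𝕜 : Type*} [Field 𝕜] [CharZero 𝕜] {L : Type*} [LieRing L] [LieAlgebra 𝕜 L]

/-- The consequences of the zero-curvature equation for the coefficient `P` of `A = (u - u(a)) P`,
where `δ = ∂/∂x` and `D = ∂/∂t + ad b`. -/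
theorem fordy_relations {α β : 𝕜} (s : 𝕜) (h₁ : α + β ≠ 0) (h₂ : 6 * α + β ≠ 0)
    (h₃ : 16 * α + β ≠ 0) (δ D : L →ₗ[𝕜] L)
    (hδ : ∀ f g, δ ⁅f, g⁆ = ⁅δ f, g⁆ + ⁅f, δ g⁆) (hD : ∀ f g, D ⁅f, g⁆ = ⁅D f, g⁆ + ⁅f, D g⁆)
    (hcomm : ∀ f, D (δ f) = δ (D f)) (P : L)
    (r₁ : ⁅P, δ (δ P)⁆ = (-4 * α) • δ P) (r₂ : ⁅P, ⁅P, δ P⁆⁆ = 0)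
    (r₃ : (-2 * β) • δ (δ (δ P)) + ⁅δ P, δ (δ (δ P))⁆ + (3 : 𝕜) • ⁅P, δ (δ (δ (δ P)))⁆
      + (3 * (8 * α - 2 * β) * s) • ⁅P, δ (δ P)⁆ - (40 * α * β * s) • δ P = 0)
    (r₄ : D P = δ (δ (δ (δ (δ P)))) + ((8 * α - 2 * β) * s) • δ (δ (δ P))
      - (20 * α * β * s ^ 2) • δ P) :
    δ (δ (δ P)) = (-8 * α * s) • δ P ∧ D P = (-4 * α * β * s ^ 2) • δ P ∧
    ⁅δ P, δ (δ P)⁆ = (-4 * α) • δ (δ P) + (8 * α * s) • ⁅P, δ P⁆ ∧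
    δ (⁅P, δ P⁆ + (4 * α) • P) = 0 ∧ D (⁅P, δ P⁆ + (4 * α) • P) = 0 ∧
    ⁅P, ⁅P, δ P⁆ + (4 * α) • P⁆ = 0 ∧ ⁅δ P, ⁅P, δ P⁆ + (4 * α) • P⁆ = 0 ∧
    ⁅δ (δ P), ⁅P, δ P⁆ + (4 * α) • P⁆ = 0 := by
  set p₁ := δ P with hp₁
  set p₂ := δ p₁ with hp₂
  set p₃ := δ p₂ with hp₃
  set p₄ := δ p₃ with hp₄
  set p₅ := δ p₄ with hp₅
  set q := ⁅P, p₁⁆ with hq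
  set K := q + (4 * α) • P with hK
  set c : 𝕜 := 2 / 5 * (6 * α + β) with hc
  have hδq : δ q = (-4 * α) • p₁ := by rw [hq, hδ, ← hp₁, ← hp₂, r₁]; simp
  have hδK : δ K = 0 := by rw [hK, map_add, map_smul, hδq, ← hp₁]; module
  have hKder (f : L) (hf : ⁅f, K⁆ = 0) : ⁅δ f, K⁆ = 0 := by
    have := congrArg δ hf
    rwa [hδ, hδK, lie_zero, add_zero, map_zero] at this
  have hPK : ⁅P, K⁆ = 0 := by rw [hK, lie_add, r₂, lie_smul, lie_self]; simp
  have hp₁K := hKder P hPK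
  have hp₂K := hKder _ hp₁K
  have hp₃K := hKder _ hp₂K
  have hp₄K := hKder _ hp₃K
  have hp₅K := hKder _ hp₄K
  rw [← hp₁] at hp₁K
  rw [← hp₁, ← hp₂] at hp₂K
  rw [← hp₁, ← hp₂, ← hp₃] at hp₃K
  rw [← hp₁, ← hp₂, ← hp₃, ← hp₄] at hp₄K
  rw [← hp₁, ← hp₂, ← hp₃, ← hp₄, ← hp₅] at hp₅K
  have e₁ : ⁅p₁, p₂⁆ + ⁅P, p₃⁆ = (-4 * α) • p₂ := by
    have := congrArg δ r₁
    rwa [hδ, map_smul] at this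
  have e₂ : (2 : 𝕜) • ⁅p₁, p₃⁆ + ⁅P, p₄⁆ = (-4 * α) • p₃ := by
    have := congrArg δ e₁
    rw [map_add, hδ, hδ, map_smul, ← hp₁, ← hp₂, ← hp₃, ← hp₄, lie_self] at this
    linear_combination (norm := module) this
  -- Eliminating `⁅P, p₄⁆` between `r₃` and `e₂` gives `⁅p₁, p₃⁆ = -c R` for exactly this
  -- combination, so `R` satisfies the eigenvector relation for `ad p₁` with value `-c`. The aim is
  -- `R = 0`.
  set R := p₃ + (8 * α * s) • p₁ with hR
  set R₁ := δ R with hR₁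
  set R₂ := δ R₁ with hR₂
  set R₃ := δ R₂ with hR₃
  have hp₁R : ⁅p₁, R⁆ = (-c) • R := by
    rw [hR, lie_add, lie_smul, lie_self]
    rw [r₁] at r₃
    linear_combination (norm := (rw [hc]; module)) (-1 / 5 : 𝕜) • r₃ + (3 / 5 : 𝕜) • e₂
  set S := ⁅P, R⁆ with hS
  have hPp₃ : ⁅P, p₃⁆ = S - (8 * α * s) • q := by
    rw [hS, hR, lie_add, lie_smul]; module
  have hp₁p₂ : ⁅p₁, p₂⁆ = (-4 * α) • p₂ - S + (8 * α * s) • q := by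
    linear_combination (norm := module) e₁ - hPp₃
  have hp₁p₃ : ⁅p₁, p₃⁆ = (-c) • R := by
    rw [← hp₁R, hR, lie_add, lie_smul, lie_self]; module
  have hδS : δ S = (c - 4 * α) • R := by
    have := congrArg δ hp₁p₂
    rw [hδ, map_add, map_sub, map_smul, map_smul, hδq, ← hp₂, ← hp₃, lie_self, hp₁p₃] at this
    linear_combination (norm := (rw [hR]; module)) this
  have hPR₁ : ⁅P, R₁⁆ = (2 * c - 4 * α) • R := by
    have := hδS
    rw [hS, hδ, ← hp₁, ← hR₁, hp₁R] at this
    linear_combination (norm := module) this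
  have hPR₂ : ⁅P, R₂⁆ = (2 * c - 4 * α) • R₁ - ⁅p₁, R₁⁆ := by
    have := congrArg δ hPR₁
    rw [hδ, map_smul, ← hp₁, ← hR₁, ← hR₂] at this
    linear_combination (norm := module) this
  have hPR₃ : ⁅P, R₃⁆ = (2 * c - 4 * α) • R₂ - (2 : 𝕜) • ⁅p₁, R₂⁆ - ⁅p₂, R₁⁆ := by
    have := congrArg δ hPR₂
    rw [hδ, map_sub, map_smul, hδ, ← hp₁, ← hp₂, ← hR₂, ← hR₃] at this
    linear_combination (norm := module) this
  have hp₁R₁ : ⁅p₂, R⁆ + ⁅p₁, R₁⁆ = (-c) • R₁ := by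
    have := congrArg δ hp₁R
    rwa [hδ, map_smul] at this
  have hp₁R₂ : ⁅p₁, R₂⁆ = (-c) • R₂ - (2 : 𝕜) • ⁅p₂, R₁⁆ - (8 * α * s * c) • R := by
    have := congrArg δ hp₁R₁
    have h3 : ⁅p₃, R⁆ = (8 * α * s * c) • R := by
      have h : p₃ = R - (8 * α * s) • p₁ := by rw [hR]; module
      rw [h, sub_lie, lie_self, smul_lie, hp₁R]; module
    rw [map_add, hδ, hδ, map_smul, ← hp₂, ← hp₃, ← hR₁, ← hR₂, h3] at this
    linear_combination (norm := module) this
  -- `N` is the part of `D P` that vanishes together with `R`.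
  set N := R₂ - (2 * β * s) • R with hN
  have hDP : D P = N + (-4 * α * β * s ^ 2) • p₁ := by
    rw [r₄, hN, hR₂, hR₁, hR]
    simp only [map_add, map_smul, ← hp₂, ← hp₃, ← hp₄, ← hp₅]
    module
  have hδN : δ N = R₃ - (2 * β * s) • R₁ := by rw [hN, map_sub, map_smul]
  have hDp₁ : D p₁ = (R₃ - (2 * β * s) • R₁) + (-4 * α * β * s ^ 2) • p₂ := by
    rw [hp₁, hcomm, hDP, map_add, map_smul, hδN]
  set Z := D K with hZ
  have hZ' : Z = (5 * c) • R₂ + (5 : 𝕜) • ⁅p₂, R₁⁆ + (6 * (4 * α - β) * s * c) • R := by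
    have hNp : ⁅N, p₁⁆ = (-1 : 𝕜) • ⁅p₁, R₂⁆ - (2 * β * s * c) • R := by
      rw [← lie_skew, hN, lie_sub, lie_smul, hp₁R]; module
    rw [hZ, hK, map_add, map_smul, hq, hD, hDp₁, hDP, add_lie, lie_add, lie_sub, lie_smul, lie_smul,
      smul_lie, lie_self, hNp, hPR₃, hPR₁, hp₁R₂, r₁, hN]
    module
  -- Apply `D` to `⁅P, K⁆ = 0`: the term `⁅D P, K⁆` drops out because `D P` is a combination of
  -- `p₁`, `p₃`, `p₅`, which commute with `K`.
  have hPZ : ⁅P, Z⁆ = 0 := by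
    have := congrArg D hPK
    rw [hD, map_zero, r₄, sub_lie, add_lie, smul_lie, smul_lie, hp₁K, hp₃K, hp₅K] at this
    simpa using this
  have hKR₁ : ⁅K, R₁⁆ = 0 := by
    rw [← lie_skew, hR₁, hR, map_add, map_smul, ← hp₄, ← hp₂, add_lie, smul_lie, hp₄K, hp₂K]
    simp
  have hqK : q = K - (4 * α) • P := by rw [hK]; module
  have hPp₁R₁ : ⁅P, ⁅p₁, R₁⁆⁆ = (-(2 * c - 4 * α) * (c + 4 * α)) • R := by
    rw [leibniz_lie, ← hq, hqK, sub_lie, smul_lie, hKR₁, hPR₁, lie_smul, hp₁R]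
    module
  have hPS : ⁅P, S⁆ = 0 := by
    have h : S = (-4 * α) • p₂ - ⁅p₁, p₂⁆ + (8 * α * s) • q := by
      rw [hp₁p₂]; module
    have h2 : ⁅q, p₂⁆ = (16 * α ^ 2) • p₁ := by
      rw [hqK, sub_lie, smul_lie, r₁, ← lie_skew, hp₂K]; module
    rw [h, lie_add, lie_sub, lie_smul, lie_smul, r₁, r₂, leibniz_lie, ← hq, h2, r₁, lie_smul,
      lie_self]
    module
  have hc0 : c ≠ 0 := by rw [hc]; simpa using h₂
  -- Expanding `⁅P, Z⁆ = 0` by the formula for `Z` yields this identity multiplied by `c`, and `c ≠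
  -- 0` is the condition `6 * α + β ≠ 0`.
  have key : (3 : 𝕜) • ⁅p₁, R₁⁆ = ((12 * α - 3 * c) * s) • S := by
    rw [hZ', lie_add, lie_add, lie_smul, lie_smul, lie_smul, hPR₂, leibniz_lie, r₁, hPR₁, smul_lie,
      lie_smul, ← hS] at hPZ
    have : c • ((3 : 𝕜) • ⁅p₁, R₁⁆) = c • (((12 * α - 3 * c) * s) • S) := by
      linear_combination (norm := skip) (-1 / 5 : 𝕜) • hPZ + (2 * c - 4 * α) • hp₁R₁
      rw [hc]
      module
    exact smul_right_injective L hc0 this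
  -- Bracketing `key` with `P` kills the right-hand side and leaves a multiple of `R` whose scalar
  -- is, up to a nonzero rational, `(α + β) * (16 * α + β)`.
  have hR0 : R = 0 := by
    have := congrArg (fun y => ⁅P, y⁆) key
    simp only [lie_smul, hPS, hPp₁R₁, smul_zero, smul_smul] at this
    refine (smul_eq_zero.mp this).resolve_left ?_
    have e1 : 2 * c - 4 * α = 4 / 5 * (α + β) := by rw [hc]; ring
    have e2 : c + 4 * α = 2 / 5 * (16 * α + β) := by rw [hc]; ring
    rw [e1, e2]
    simp [h₁, h₃]
  have hR₁0 : R₁ = 0 := by rw [hR₁, hR0, map_zero]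
  have hR₂0 : R₂ = 0 := by rw [hR₂, hR₁0, map_zero]
  have hN0 : N = 0 := by rw [hN, hR₂0, hR0]; simp
  refine ⟨?_, ?_, ?_, hδK, ?_, hPK, hp₁K, hp₂K⟩
  · linear_combination (norm := module) hR0
  · rw [hDP, hN0, zero_add]
  · rw [hp₁p₂, hS, hR0, lie_zero, sub_zero]
  · rw [hZ', hR₂0, hR₁0, hR0]; simp

end Algebra

end EvolutionEquation

end

/-! ### The covariant total derivative and its commutators with the partial derivatives. -/

noncomputable section

namespace EvolutionEquation

open MvPolynomial LieSeries

section CovariantDerivative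

variable {𝕜 : Type*} [Field 𝕜] {L : Type*} [LieRing L] [LieAlgebra 𝕜 L]

/-- The covariant total derivative `D_x + ad A` on series which depend on
`x, t, u_0, …, u_4` only. -/
def covDx (a : Coord → 𝕜) (A f : LieSeries L) : LieSeries L :=
  pd .x f + uAt a 1 • pd (.u 0) f + uAt a 2 • pd (.u 1) f + uAt a 3 • pd (.u 2) f
    + uAt a 4 • pd (.u 3) f + uAt a 5 • pd (.u 4) f + ⁅A, f⁆

variable (a : Coord → 𝕜) (A f g : LieSeries L)

theorem covDx_zero : covDx a A 0 = 0 := by simp [covDx]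

theorem covDx_add : covDx a A (f + g) = covDx a A f + covDx a A g := by
  simp only [covDx, map_add, lie_add]; module

theorem covDx_neg : covDx a A (-f) = -covDx a A f := by
  simp only [covDx, map_neg, lie_neg]; module

theorem covDx_sub : covDx a A (f - g) = covDx a A f - covDx a A g := by
  rw [sub_eq_add_neg, covDx_add, covDx_neg, sub_eq_add_neg]

theorem covDx_poly_smul (h : MvPolynomial Coord 𝕜) :
    covDx a A (h • f) = (pderiv .x h + uAt a 1 * pderiv (.u 0) h + uAt a 2 * pderiv (.u 1) h
      + uAt a 3 * pderiv (.u 2) h + uAt a 4 * pderiv (.u 3) h + uAt a 5 * pderiv (.u 4) h) • f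
      + h • covDx a A f := by
  simp only [covDx, pd_poly_smul, lie_smul]; module

theorem covDx_C_smul (r : 𝕜) :
    covDx a A ((C r : MvPolynomial Coord 𝕜) • f) = (C r : MvPolynomial Coord 𝕜) • covDx a A f := by
  simp [covDx_poly_smul]

theorem covDx_uAt_smul {k : ℕ} (hk : k < 5) :
    covDx a A (uAt a k • f) = uAt a (k + 1) • f + uAt a k • covDx a A f := by
  rw [covDx_poly_smul]
  congr 2
  interval_cases k <;> simp [pderiv_uAt, pderiv_x_uAt]

theorem covDx_X_smul : covDx a A ((X (.u 0) : MvPolynomial Coord 𝕜) • f)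
    = uAt a 1 • f + (X (.u 0) : MvPolynomial Coord 𝕜) • covDx a A f := by
  rw [covDx_poly_smul]
  congr 2
  simp [pderiv_X]

theorem covDx_lie : covDx a A ⁅f, g⁆ = ⁅covDx a A f, g⁆ + ⁅f, covDx a A g⁆ := by
  simp only [covDx, pd_lie, add_lie, lie_add, smul_lie, lie_smul, leibniz_lie A f g]
  module

theorem pd_zero_covDx :
    pd (.u 0) (covDx a A f) = covDx a A (pd (.u 0) f) + ⁅pd (.u 0) A, f⁆ := by
  simp only [covDx, pd_lie, map_add, pd_poly_smul, pderiv_uAt, pd_comm (.u 0)]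
  simp
  module

/-- `∂/∂u_{k+1}` differentiates the coefficient of `∂/∂u_k` in `D_x`, which produces the extra term.
The bound on `k` reflects the truncation of `covDx` at `∂/∂u_4`. -/
theorem pd_succ_covDx {k : ℕ} (hk : k < 5) :
    pd (.u (k + 1)) (covDx a A f)
      = covDx a A (pd (.u (k + 1)) f) + pd (.u k) f + ⁅pd (.u (k + 1)) A, f⁆ := by
  simp only [covDx, pd_lie, map_add, pd_poly_smul, pderiv_uAt, pd_comm (.u (k + 1))]
  interval_cases k <;> norm_num <;> module

end CovariantDerivative

end EvolutionEquation

end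

/-! ### The derivatives of `B` in terms of `A`. -/

noncomputable section

namespace EvolutionEquation

open MvPolynomial LieSeries

section Reduction

variable {𝕜 : Type*} [Field 𝕜] {L : Type*} [LieRing L] [LieAlgebra 𝕜 L]

theorem eq_zero_of_C_smul {r : 𝕜} (hr : r ≠ 0) {f : LieSeries L}
    (h : (C r : MvPolynomial Coord 𝕜) • f = 0) : f = 0 := by
  rw [C_smul] at h
  exact (smul_eq_zero.mp h).resolve_left hr

theorem eq_zero_of_ofNat_smul [CharZero 𝕜] (n : ℕ) [n.AtLeastTwo] {f : LieSeries L}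
    (h : (OfNat.ofNat n : MvPolynomial Coord 𝕜) • f = 0) : f = 0 := by
  refine eq_zero_of_C_smul (𝕜 := 𝕜) (r := OfNat.ofNat n) (OfNat.ofNat_ne_zero n) ?_
  rwa [map_ofNat]

variable {α β : 𝕜} {a : Coord → 𝕜} {A B : LieSeries L}

/-- The zero-curvature equation for Fordy's equation. -/
def FordyZCR (α β : 𝕜) (a : Coord → 𝕜) (A B : LieSeries L) : Prop :=
  covDx a A B = pd .t A + uAt a 5 • pd (.u 0) A
    + (C (4 * α - 6 * β) : MvPolynomial Coord 𝕜) • uAt a 1 • uAt a 2 • pd (.u 0) A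
    + (C (8 * α - 2 * β) : MvPolynomial Coord 𝕜) • uAt a 0 • uAt a 3 • pd (.u 0) A
    - (C (20 * α * β) : MvPolynomial Coord 𝕜) • uAt a 0 • uAt a 0 • uAt a 1 • pd (.u 0) A

theorem mk_zeroCurvature_eq_zero_iff :
    LieSeries.mk (zeroCurvature (fordyRHS α β) a 0 (0 + 5 - 1) A.coeff B.coeff) = 0 ↔
      FordyZCR α β a A B := by
  rw [zeroCurvature_fordy, FordyZCR, ← sub_eq_zero (a := covDx a A B), covDx]
  refine iff_of_eq (congrArg (· = 0) ?_)
  module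

/-- The derivatives of `B` with respect to the `u_k`. -/
theorem FordyZCR.pd_B (hZ : FordyZCR α β a A B) (hA : ∀ k, 1 ≤ k → pd (.u k) A = 0)
    (hB : ∀ k, 5 ≤ k → pd (.u k) B = 0) :
    pd (.u 4) B = pd (.u 0) A ∧ pd (.u 3) B = -covDx a A (pd (.u 0) A) ∧
    pd (.u 2) B = (C (8 * α - 2 * β) : MvPolynomial Coord 𝕜) • uAt a 0 • pd (.u 0) A
      + covDx a A (covDx a A (pd (.u 0) A)) ∧
    pd (.u 1) B = (C (4 * α - 6 * β) : MvPolynomial Coord 𝕜) • uAt a 1 • pd (.u 0) A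
      - covDx a A (pd (.u 2) B) ∧
    pd (.u 0) B = (C (4 * α - 6 * β) : MvPolynomial Coord 𝕜) • uAt a 2 • pd (.u 0) A
      - (C (20 * α * β) : MvPolynomial Coord 𝕜) • uAt a 0 • uAt a 0 • pd (.u 0) A
      - covDx a A (pd (.u 1) B) := by
  have hA0 (k : ℕ) (hk : 1 ≤ k) : pd (.u k) (pd (.u 0) A) = 0 := by
    rw [pd_comm, hA k hk, map_zero]
  have hAt (k : ℕ) (hk : 1 ≤ k) : pd (.u k) (pd .t A) = 0 := by
    rw [pd_comm, hA k hk, map_zero]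
  -- Differentiating in `u_{k+1}` isolates `∂B/∂u_k`, so the derivatives of `B` are found
  -- recursively from `k = 4` down to `k = 0`.
  have step (k : ℕ) (hk : k < 5) := congrArg (pd (.u (k + 1))) hZ
  simp only [map_add, map_sub, pd_poly_smul, pderiv_uAt, hA0 _ (Nat.le_add_left 1 _), pderiv_C,
    hAt _ (Nat.le_add_left 1 _)] at step
  have step' (k : ℕ) (hk : k < 5) := (pd_succ_covDx a A B hk).symm.trans (step k hk)
  simp only [hA _ (Nat.le_add_left 1 _), zero_lie] at step'
  have s4 := step' 4 (by norm_num)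
  have s3 := step' 3 (by norm_num)
  have s2 := step' 2 (by norm_num)
  have s1 := step' 1 (by norm_num)
  have s0 := step' 0 (by norm_num)
  norm_num [hB 5 le_rfl, covDx_zero] at s4 s3 s2 s1 s0
  have e3 : pd (.u 3) B = -covDx a A (pd (.u 0) A) := by
    rw [s4] at s3
    linear_combination (norm := module) s3
  have e2 : pd (.u 2) B = (C (8 * α - 2 * β) : MvPolynomial Coord 𝕜) • uAt a 0 • pd (.u 0) A
      + covDx a A (covDx a A (pd (.u 0) A)) := by
    rw [e3, covDx_neg] at s2
    simp only [map_sub, map_mul]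
    linear_combination (norm := module) s2
  refine ⟨s4, e3, e2, ?_, ?_⟩
  · simp only [map_sub, map_mul]
    linear_combination (norm := module) s1
  · simp only [map_sub, map_mul]
    linear_combination (norm := module) s0

end Reduction

end EvolutionEquation

end

/-! ### Linearity of `A` in `u_0`. -/

noncomputable section

namespace EvolutionEquation

open MvPolynomial LieSeries

section Linear

theorem coeff_eq_zero_of_pd_eq_zero (𝕜 : Type*) [Field 𝕜] [CharZero 𝕜] {L : Type*} [LieRing L]
    [LieAlgebra 𝕜 L] {f : LieSeries L} {v : Coord} (h : pd v f = 0)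
    {m : Coord →₀ ℕ} (hm : m v ≠ 0) : f.coeff m = 0 := by
  have hle : Finsupp.single v 1 ≤ m := by
    rw [Finsupp.single_le_iff]; omega
  have h1 := congrArg (fun g => LieSeries.coeff g (m - Finsupp.single v 1)) h
  simp only [coeff_pd, tsub_add_cancel_of_le hle, LieSeries.coeff_zero] at h1
  rw [← Nat.cast_smul_eq_nsmul 𝕜] at h1
  exact (smul_eq_zero.mp h1).resolve_left (Nat.cast_ne_zero.mpr (Nat.succ_ne_zero _))

theorem eq_zero_of_pd_u_eq_zero (𝕜 : Type*) [Field 𝕜] [CharZero 𝕜] {L : Type*} [LieRing L]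
    [LieAlgebra 𝕜 L] {f : LieSeries L} (h : ∀ k, pd (.u k) f = 0)
    (h0 : ∀ m, NoU m → f.coeff m = 0) : f = 0 := by
  ext m
  by_cases hm : NoU m
  · exact h0 m hm
  · simp only [NoU, not_forall] at hm
    obtain ⟨k, hk⟩ := hm
    exact coeff_eq_zero_of_pd_eq_zero 𝕜 (h k) hk

variable {𝕜 : Type*} [Field 𝕜] [CharZero 𝕜] {L : Type*} [LieRing L] [LieAlgebra 𝕜 L]

variable {α β : 𝕜} {a : Coord → 𝕜} {A B : LieSeries L}

/-- An integrability condition: the mixed derivatives of `B` obtained from `pd_B` must agree in both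
orders. -/
theorem FordyZCR.pd_pd_A (hZ : FordyZCR α β a A B) (hA : ∀ k, 1 ≤ k → pd (.u k) A = 0)
    (hB : ∀ k, 5 ≤ k → pd (.u k) B = 0) (h₂ : 6 * α + β ≠ 0) :
    pd (.u 0) (pd (.u 0) A) = 0 := by
  obtain ⟨-, -, b2, b1, b0⟩ := hZ.pd_B hA hB
  set A' := pd (.u 0) A with hA'
  set A'' := pd (.u 0) A' with hA''
  have hA0 (k : ℕ) (hk : 1 ≤ k) : pd (.u k) A' = 0 := by
    rw [hA', pd_comm, hA k hk, map_zero]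
  have hA00 (k : ℕ) (hk : 1 ≤ k) : pd (.u k) A'' = 0 := by
    rw [hA'', pd_comm, hA0 k hk, map_zero]
  have d0 (f : LieSeries L) := pd_zero_covDx a A f
  have d1 (f : LieSeries L) : pd (.u 1) (covDx a A f) = covDx a A (pd (.u 1) f) + pd (.u 0) f := by
    rw [pd_succ_covDx a A f (by norm_num : 0 < 5), hA _ le_rfl]; simp
  have d2 (f : LieSeries L) : pd (.u 2) (covDx a A f) = covDx a A (pd (.u 2) f) + pd (.u 1) f := by
    rw [pd_succ_covDx a A f (by norm_num : 1 < 5), hA _ (by norm_num)]; simp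
  simp only [← hA'] at d0
  -- the second derivatives of `B`
  have b12 : pd (.u 1) (pd (.u 2) B) = (2 : MvPolynomial Coord 𝕜) • covDx a A A'' := by
    rw [b2]
    simp only [map_add, pd_poly_smul, pderiv_uAt, pderiv_C, d1, d0, hA0 1 le_rfl, covDx_zero,
      lie_self, zero_add, add_zero, ← hA'']
    simp
    module
  have b22 : pd (.u 2) (pd (.u 2) B) = A'' := by
    rw [b2]
    simp only [map_add, pd_poly_smul, pderiv_uAt, pderiv_C, d2, d1, hA0 1 le_rfl,
      hA0 2 (by norm_num), covDx_zero, zero_add, add_zero, ← hA'']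
    simp
  -- The derivative of `B` in `u_1` and `u_2` is `2∇A''` in one order and `-3∇A''` in the other.
  have cA'' : covDx a A A'' = 0 := by
    have h : pd (.u 2) (pd (.u 1) B) = -(3 : MvPolynomial Coord 𝕜) • covDx a A A'' := by
      rw [b1]
      simp only [map_sub, pd_poly_smul, pderiv_uAt, pderiv_C, d2, b22, b12, hA0 2 (by norm_num)]
      simp
      module
    rw [pd_comm, b12] at h
    refine eq_zero_of_ofNat_smul (𝕜 := 𝕜) 5 ?_
    linear_combination (norm := module) h
  have hA3 : pd (.u 0) A'' = 0 := by
    have h := congrArg (pd (.u 1)) cA''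
    rwa [d1, hA00 1 le_rfl, covDx_zero, zero_add, map_zero] at h
  have hlie : ⁅A', A''⁆ = 0 := by
    have h := congrArg (pd (.u 0)) cA''
    rwa [d0, hA3, covDx_zero, zero_add, map_zero] at h
  have hlie' : ⁅A'', covDx a A A'⁆ = 0 := by
    have h := congrArg (covDx a A) hlie
    rw [covDx_lie, cA'', lie_zero, add_zero, covDx_zero] at h
    rw [← lie_skew, h, neg_zero]
  have b12' : pd (.u 1) (pd (.u 2) B) = 0 := by rw [b12, cA'', smul_zero]
  have b02 : pd (.u 0) (pd (.u 2) B) = (C (8 * α - 2 * β) : MvPolynomial Coord 𝕜) • A'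
      + (C (8 * α - 2 * β) : MvPolynomial Coord 𝕜) • uAt a 0 • A'' + ⁅A', covDx a A A'⁆ := by
    rw [b2]
    simp only [map_add, pd_poly_smul, pderiv_uAt, pderiv_C, d0, cA'', lie_self, ← hA'']
    simp [covDx_zero]
  have b11 : pd (.u 1) (pd (.u 1) B)
      = (C (4 * α - 6 * β) : MvPolynomial Coord 𝕜) • A' - pd (.u 0) (pd (.u 2) B) := by
    rw [b1]
    simp only [map_sub, pd_poly_smul, pderiv_uAt, pderiv_C, d1, b12', covDx_zero, hA0 1 le_rfl]
    simp
  have b01 : pd (.u 0) (pd (.u 1) B) + pd (.u 0) (pd (.u 1) B)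
      = -covDx a A (pd (.u 1) (pd (.u 1) B)) := by
    have h := congrArg (pd (.u 1)) b0
    rw [pd_comm] at h
    simp only [map_sub, pd_poly_smul, pderiv_uAt, pderiv_C, d1, hA0 1 le_rfl] at h
    norm_num at h
    linear_combination (norm := module) h
  -- Differentiating `b01` in `u_1` gives `2y = -y` for this derivative `y`, because the third
  -- derivative of `B` in `u_1` is zero. Substituting `b11` and `b02` then turns it into `-2(6α +
  -- β)A''`.
  have b011 : pd (.u 0) (pd (.u 1) (pd (.u 1) B)) = 0 := by
    have h := congrArg (pd (.u 1)) b01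
    have h1 : pd (.u 1) (pd (.u 1) (pd (.u 1) B)) = 0 := by
      rw [b11, map_sub, pd_comm (.u 1) (.u 0), b12', pd_poly_smul, hA0 1 le_rfl]
      simp
    rw [map_add, map_neg, d1, h1, covDx_zero, zero_add, pd_comm (.u 1) (.u 0)] at h
    refine eq_zero_of_ofNat_smul (𝕜 := 𝕜) 3 ?_
    linear_combination (norm := module) h
  rw [b11, b02] at b011
  simp only [map_sub, map_add, pd_poly_smul, pderiv_uAt, pderiv_C, ← hA'', hA3, pd_lie, d0, cA'',
    hlie', lie_self] at b011
  simp only [if_true, lie_zero, smul_zero, one_smul, add_zero] at b011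
  refine eq_zero_of_C_smul (r := -2 * (6 * α + β)) (by simpa using h₂) ?_
  simp only [map_mul, map_add, map_neg, map_ofNat] at ⊢
  simp only [map_mul, map_ofNat] at b011
  linear_combination (norm := module) b011

end Linear

end EvolutionEquation

end

/-! ### Series in `x, t` alone, and the explicit part of `B`. -/

noncomputable section

namespace EvolutionEquation

open MvPolynomial LieSeries

section UFree

variable {𝕜 : Type*} [Field 𝕜] {L : Type*} [LieRing L] [LieAlgebra 𝕜 L]

/-- The series involves none of the `u_k`. -/
def UFree (f : LieSeries L) : Prop := ∀ k, pd (.u k) f = 0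

namespace UFree

variable {f g : LieSeries L}

theorem add (hf : UFree f) (hg : UFree g) : UFree (f + g) := fun k => by
  rw [map_add, hf k, hg k, add_zero]

theorem sub (hf : UFree f) (hg : UFree g) : UFree (f - g) := fun k => by
  rw [map_sub, hf k, hg k, sub_zero]

theorem lie (hf : UFree f) (hg : UFree g) : UFree ⁅f, g⁆ := fun k => by
  rw [pd_lie, hf k, hg k, zero_lie, lie_zero, add_zero]

theorem pd (hf : UFree f) (v : Coord) : UFree (LieSeries.pd v f) := fun k => by
  rw [pd_comm, hf k, map_zero]

theorem C_smul (hf : UFree f) (r : 𝕜) : UFree ((C r : MvPolynomial Coord 𝕜) • f) := fun k => by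
  rw [pd_poly_smul, hf k, pderiv_C, zero_smul, smul_zero, add_zero]

theorem smul (hf : UFree f) (r : 𝕜) : UFree (r • f) := fun k => by
  rw [pd_smul, hf k, smul_zero]

theorem covDx_eq (hf : UFree f) (a : Coord → 𝕜) (P : LieSeries L) :
    covDx a ((X (.u 0) : MvPolynomial Coord 𝕜) • P) f
      = LieSeries.pd .x f + (X (.u 0) : MvPolynomial Coord 𝕜) • ⁅P, f⁆ := by
  simp [covDx, hf _]

variable [CharZero 𝕜]

/-- Comparison of coefficients of powers of `u_0 - a_0`, carried out by differentiating twice. -/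
theorem cubic_eq_zero {f₀ f₁ f₂ : LieSeries L} (h₀ : UFree f₀) (h₁ : UFree f₁) (h₂ : UFree f₂)
    (h : f₀ + (X (.u 0) : MvPolynomial Coord 𝕜) • f₁
      + (X (.u 0) : MvPolynomial Coord 𝕜) • (X (.u 0) : MvPolynomial Coord 𝕜) • f₂ = 0) :
    f₀ = 0 ∧ f₁ = 0 ∧ f₂ = 0 := by
  have e1 := congrArg (LieSeries.pd (.u 0)) h
  simp only [map_add, pd_poly_smul, h₀ 0, h₁ 0, h₂ 0, pderiv_X_self, map_zero, smul_zero,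
    add_zero, zero_add, one_smul] at e1
  have e2 := congrArg (LieSeries.pd (.u 0)) e1
  simp only [map_add, pd_poly_smul, h₁ 0, h₂ 0, pderiv_X_self, map_zero, smul_zero,
    add_zero, zero_add, one_smul] at e2
  have e3 : f₂ = 0 := by
    refine eq_zero_of_ofNat_smul (𝕜 := 𝕜) 2 ?_
    linear_combination (norm := module) e2
  subst e3
  simp only [smul_zero, add_zero] at e1
  subst e1
  simpa using h

end UFree

end UFree

section Explicit

variable {𝕜 : Type*} [Field 𝕜] {L : Type*} [LieRing L] [LieAlgebra 𝕜 L]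

variable (𝕜) in
/-- The difference of the coordinate `u_0` and its value at the point. -/
abbrev v₀ : MvPolynomial Coord 𝕜 := X (.u 0)

/-- Six times the part of `B` which is determined by the coefficient `P` of
`A = (u_0 - a_0) P`. -/
def explicitB (α β : 𝕜) (a : Coord → 𝕜) (P : LieSeries L) : LieSeries L :=
  (6 : MvPolynomial Coord 𝕜) • uAt a 4 • P - (6 : MvPolynomial Coord 𝕜) • uAt a 3 • pd .x P
  + (6 : MvPolynomial Coord 𝕜) • uAt a 2 • (pd .x (pd .x P) + v₀ 𝕜 • ⁅P, pd .x P⁆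
    + (C (8 * α - 2 * β) : MvPolynomial Coord 𝕜) • uAt a 0 • P)
  - (6 : MvPolynomial Coord 𝕜) • uAt a 1 • (pd .x (pd .x (pd .x P))
    - (C (8 * α) : MvPolynomial Coord 𝕜) • v₀ 𝕜 • pd .x P
    + (C (8 * α - 2 * β) : MvPolynomial Coord 𝕜) • uAt a 0 • pd .x P)
  - (3 : MvPolynomial Coord 𝕜) • uAt a 1 • uAt a 1 • (⁅P, pd .x P⁆
    + (C (4 * α + 4 * β) : MvPolynomial Coord 𝕜) • P)
  + (6 : MvPolynomial Coord 𝕜) • v₀ 𝕜 • (pd .x (pd .x (pd .x (pd .x P)))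
    + (C ((8 * α - 2 * β) * a (.u 0)) : MvPolynomial Coord 𝕜) • pd .x (pd .x P)
    - (C (20 * α * β * a (.u 0) ^ 2) : MvPolynomial Coord 𝕜) • P)
  + (3 : MvPolynomial Coord 𝕜) • v₀ 𝕜 • v₀ 𝕜 • ((C (-2 * β) : MvPolynomial Coord 𝕜) • pd .x (pd .x P)
    + ⁅P, pd .x (pd .x (pd .x P))⁆
    + (C ((8 * α - 2 * β) * a (.u 0)) : MvPolynomial Coord 𝕜) • ⁅P, pd .x P⁆
    - (C (40 * α * β * a (.u 0)) : MvPolynomial Coord 𝕜) • P)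
  + (2 : MvPolynomial Coord 𝕜) • v₀ 𝕜 • v₀ 𝕜 • v₀ 𝕜 • ((C (-2 * β) : MvPolynomial Coord 𝕜) • ⁅P, pd .x P⁆
    - (C (20 * α * β) : MvPolynomial Coord 𝕜) • P)

/-- Obtained from the `x`-derivatives of `r₁` and `r₂` and the Jacobi identity. It removes one
contribution to the coefficient of `(u_0 - a_0)³` in `covDx_explicitB`. -/
theorem lie_lie_pd_x_three {α : 𝕜} {P : LieSeries L}
    (r₁ : ⁅P, pd .x (pd .x P)⁆ = (C (-4 * α) : MvPolynomial Coord 𝕜) • pd .x P)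
    (r₂ : ⁅P, ⁅P, pd .x P⁆⁆ = 0) : ⁅P, ⁅P, pd .x (pd .x (pd .x P))⁆⁆ = 0 := by
  rw [C_smul] at r₁
  have e₀ := congrArg (pd .x) r₁
  rw [pd_lie, pd_smul] at e₀
  have e₁ := congrArg (pd .x) r₂
  rw [pd_lie, pd_lie, lie_self, zero_add, map_zero, r₁, lie_smul] at e₁
  have e₂ := congrArg (pd .x) e₁
  rw [map_add, pd_lie, pd_smul, pd_lie, lie_self, zero_add, map_zero, r₁, lie_smul, lie_self,
    smul_zero, add_zero] at e₂
  have e₃ := leibniz_lie P (pd .x P) (pd .x (pd .x P))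
  rw [r₁, lie_smul, lie_self, smul_zero, add_zero, ← lie_skew ⁅P, pd .x P⁆] at e₃
  have e₄ := congrArg (fun f => ⁅P, f⁆) e₀
  simp only [lie_add, lie_smul, r₁] at e₄
  linear_combination (norm := module) e₄ + e₂ - e₃

/-- The first group on the right is six times the `F`-part of `D_t A`. The other two are the defects
of degree 1 and 2 in `u_0 - a_0`; those of degree 3 and 4 cancel by `r₁`, `r₂` and `r₃`. The factor
6 clears the denominators 2 and 3 that come from integration in `u_1` and `u_0`. -/
theorem covDx_explicitB {α β : 𝕜} {a : Coord → 𝕜} {P : LieSeries L} (hP : UFree P)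
    (r₁ : ⁅P, pd .x (pd .x P)⁆ = (C (-4 * α) : MvPolynomial Coord 𝕜) • pd .x P)
    (r₂ : ⁅P, ⁅P, pd .x P⁆⁆ = 0) :
    covDx a (v₀ 𝕜 • P) (explicitB α β a P) =
      (6 : MvPolynomial Coord 𝕜) • (uAt a 5 • P
        + (C (4 * α - 6 * β) : MvPolynomial Coord 𝕜) • uAt a 1 • uAt a 2 • P
        + (C (8 * α - 2 * β) : MvPolynomial Coord 𝕜) • uAt a 0 • uAt a 3 • P
        - (C (20 * α * β) : MvPolynomial Coord 𝕜) • uAt a 0 • uAt a 0 • uAt a 1 • P)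
      + (6 : MvPolynomial Coord 𝕜) • v₀ 𝕜 • (pd .x (pd .x (pd .x (pd .x (pd .x P))))
        + (C ((8 * α - 2 * β) * a (.u 0)) : MvPolynomial Coord 𝕜) • pd .x (pd .x (pd .x P))
        - (C (20 * α * β * a (.u 0) ^ 2) : MvPolynomial Coord 𝕜) • pd .x P)
      + (3 : MvPolynomial Coord 𝕜) • v₀ 𝕜 • v₀ 𝕜 •
        ((C (-2 * β) : MvPolynomial Coord 𝕜) • pd .x (pd .x (pd .x P))
        + ⁅pd .x P, pd .x (pd .x (pd .x P))⁆
        + (3 : MvPolynomial Coord 𝕜) • ⁅P, pd .x (pd .x (pd .x (pd .x P)))⁆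
        + (C (3 * (8 * α - 2 * β) * a (.u 0)) : MvPolynomial Coord 𝕜) • ⁅P, pd .x (pd .x P)⁆
        - (C (40 * α * β * a (.u 0)) : MvPolynomial Coord 𝕜) • pd .x P) := by
  have r₃ := lie_lie_pd_x_three r₁ r₂
  have hn (n : ℕ) [n.AtLeastTwo] (f : LieSeries L) :
      covDx a (v₀ 𝕜 • P) ((OfNat.ofNat n : MvPolynomial Coord 𝕜) • f)
        = (OfNat.ofNat n : MvPolynomial Coord 𝕜) • covDx a (v₀ 𝕜 • P) f := by
    rw [← map_ofNat C, covDx_C_smul]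
  have h0 : uAt a 0 = v₀ 𝕜 + C (a (.u 0)) := rfl
  rw [explicitB]
  simp only [covDx_add, covDx_sub, hn, covDx_C_smul, covDx_X_smul, covDx_lie,
    covDx_uAt_smul a _ _ (by norm_num : 4 < 5), covDx_uAt_smul a _ _ (by norm_num : 3 < 5),
    covDx_uAt_smul a _ _ (by norm_num : 2 < 5), covDx_uAt_smul a _ _ (by norm_num : 1 < 5),
    covDx_uAt_smul a _ _ (by norm_num : 0 < 5), hP.covDx_eq, (hP.pd .x).covDx_eq,
    ((hP.pd .x).pd .x).covDx_eq, (((hP.pd .x).pd .x).pd .x).covDx_eq,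
    ((((hP.pd .x).pd .x).pd .x).pd .x).covDx_eq, lie_self, smul_zero, add_zero, lie_add, lie_smul,
    r₁, r₂, r₃, zero_add, smul_add, smul_zero, Nat.reduceAdd]
  simp only [h0, map_sub, map_mul, map_add, map_neg, map_ofNat, map_pow]
  module

end Explicit

end EvolutionEquation

end

/-! ### Reduction of the zero-curvature equation to relations for `P` and `b`. -/

noncomputable section

namespace EvolutionEquation

open MvPolynomial LieSeries

section Forward

variable {𝕜 : Type*} [Field 𝕜] {L : Type*} [LieRing L] [LieAlgebra 𝕜 L]

variable {α β : 𝕜} {a : Coord → 𝕜} {A B P b : LieSeries L}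

/-- With `B` of this form the defect of the equation is a quadratic polynomial in `u_0 - a_0` with
coefficients free of the `u_k`; the three conditions are its coefficients. One direction extracts
relations from the universal solution, the other verifies the solution built from exponentials. -/
theorem fordyZCR_iff [CharZero 𝕜] (hP : UFree P) (hb : UFree b)
    (r₁ : ⁅P, pd .x (pd .x P)⁆ = (C (-4 * α) : MvPolynomial Coord 𝕜) • pd .x P)
    (r₂ : ⁅P, ⁅P, pd .x P⁆⁆ = 0)
    (hB : (6 : MvPolynomial Coord 𝕜) • B
      = explicitB α β a P + (6 : MvPolynomial Coord 𝕜) • b) :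
    FordyZCR α β a (v₀ 𝕜 • P) B ↔
      pd .x b = 0 ∧
      pd .t P + ⁅b, P⁆ = pd .x (pd .x (pd .x (pd .x (pd .x P))))
        + ((8 * α - 2 * β) * a (.u 0)) • pd .x (pd .x (pd .x P))
        - (20 * α * β * a (.u 0) ^ 2) • pd .x P ∧
      (-2 * β) • pd .x (pd .x (pd .x P)) + ⁅pd .x P, pd .x (pd .x (pd .x P))⁆
        + (3 : 𝕜) • ⁅P, pd .x (pd .x (pd .x (pd .x P)))⁆
        + (3 * (8 * α - 2 * β) * a (.u 0)) • ⁅P, pd .x (pd .x P)⁆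
        - (40 * α * β * a (.u 0)) • pd .x P = 0 := by
  have hn (n : ℕ) [n.AtLeastTwo] (f : LieSeries L) :
      covDx a (v₀ 𝕜 • P) ((OfNat.ofNat n : MvPolynomial Coord 𝕜) • f)
        = (OfNat.ofNat n : MvPolynomial Coord 𝕜) • covDx a (v₀ 𝕜 • P) f := by
    rw [← map_ofNat C, covDx_C_smul]
  have hA : pd (.u 0) (v₀ 𝕜 • P) = P := by
    rw [pd_poly_smul, pderiv_X_self, hP 0, one_smul, smul_zero, add_zero]
  have hAt : pd .t (v₀ 𝕜 • P) = v₀ 𝕜 • pd .t P := by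
    rw [pd_poly_smul, pderiv_X_of_ne (by simp), zero_smul, zero_add]
  have hc := congrArg (covDx a (v₀ 𝕜 • P)) hB
  rw [hn, covDx_add, hn, covDx_explicitB hP r₁ r₂, hb.covDx_eq] at hc
  set f₁ := pd .x (pd .x (pd .x (pd .x (pd .x P))))
        + ((8 * α - 2 * β) * a (.u 0)) • pd .x (pd .x (pd .x P))
        - (20 * α * β * a (.u 0) ^ 2) • pd .x P - (pd .t P + ⁅b, P⁆) with hf₁
  set f₂ := (-2 * β) • pd .x (pd .x (pd .x P)) + ⁅pd .x P, pd .x (pd .x (pd .x P))⁆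
        + (3 : 𝕜) • ⁅P, pd .x (pd .x (pd .x (pd .x P)))⁆
        + (3 * (8 * α - 2 * β) * a (.u 0)) • ⁅P, pd .x (pd .x P)⁆
        - (40 * α * β * a (.u 0)) • pd .x P with hf₂
  have hP1 := hP.pd .x
  have hP2 := hP1.pd .x
  have hP3 := hP2.pd .x
  have hP4 := hP3.pd .x
  have hP5 := hP4.pd .x
  have u₁ : UFree f₁ :=
    ((hP5.add (hP3.smul _)).sub (hP1.smul _)).sub ((hP.pd .t).add (hb.lie hP))
  have u₂ : UFree f₂ :=
    (((((hP3.smul _).add (hP1.lie hP3)).add ((hP.lie hP4).smul _)).add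
      ((hP.lie hP2).smul _))).sub (hP1.smul _)
  have h₆ : UFree ((6 : MvPolynomial Coord 𝕜) • pd .x b) := by
    rw [← map_ofNat C]; exact (hb.pd .x).C_smul _
  have h₆' : UFree ((6 : MvPolynomial Coord 𝕜) • f₁) := by
    rw [← map_ofNat C]; exact u₁.C_smul _
  have h₆'' : UFree ((3 : MvPolynomial Coord 𝕜) • f₂) := by
    rw [← map_ofNat C]; exact u₂.C_smul _
  have main : (6 : MvPolynomial Coord 𝕜) • (covDx a (v₀ 𝕜 • P) B - (v₀ 𝕜 • pd .t P + uAt a 5 • P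
      + (C (4 * α - 6 * β) : MvPolynomial Coord 𝕜) • uAt a 1 • uAt a 2 • P
      + (C (8 * α - 2 * β) : MvPolynomial Coord 𝕜) • uAt a 0 • uAt a 3 • P
      - (C (20 * α * β) : MvPolynomial Coord 𝕜) • uAt a 0 • uAt a 0 • uAt a 1 • P))
      = (6 : MvPolynomial Coord 𝕜) • pd .x b + v₀ 𝕜 • (6 : MvPolynomial Coord 𝕜) • f₁
        + v₀ 𝕜 • v₀ 𝕜 • (3 : MvPolynomial Coord 𝕜) • f₂ := by
    have h3 : (3 : 𝕜) • ⁅P, pd .x (pd .x (pd .x (pd .x P)))⁆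
        = (3 : MvPolynomial Coord 𝕜) • ⁅P, pd .x (pd .x (pd .x (pd .x P)))⁆ := by
      rw [← C_smul, map_ofNat]
    rw [smul_sub, hc, hf₁, hf₂, h3, ← lie_skew b P]
    simp only [← C_smul]
    module
  rw [FordyZCR, hA, hAt, ← sub_eq_zero]
  constructor
  · intro h
    rw [h, smul_zero] at main
    obtain ⟨h1, h2, h3⟩ := UFree.cubic_eq_zero h₆ h₆' h₆'' main.symm
    have h1 := eq_zero_of_ofNat_smul (𝕜 := 𝕜) 6 h1
    have h2 := eq_zero_of_ofNat_smul (𝕜 := 𝕜) 6 h2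
    exact ⟨h1, (sub_eq_zero.mp h2).symm, eq_zero_of_ofNat_smul (𝕜 := 𝕜) 3 h3⟩
  · rintro ⟨h1, h2, h3⟩
    have h2' : f₁ = 0 := by rw [hf₁, h2, sub_self]
    rw [h1, h2', h3] at main
    simp only [smul_zero, add_zero] at main
    exact eq_zero_of_ofNat_smul (𝕜 := 𝕜) 6 main

theorem pd_explicitB_zero (hP : UFree P) : pd (.u 0) (explicitB α β a P) =
    (6 : MvPolynomial Coord 𝕜) • uAt a 2 • (⁅P, pd .x P⁆
      + (C (8 * α - 2 * β) : MvPolynomial Coord 𝕜) • P)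
    - (6 : MvPolynomial Coord 𝕜) • uAt a 1 • (C (-2 * β) : MvPolynomial Coord 𝕜) • pd .x P
    + (6 : MvPolynomial Coord 𝕜) • (pd .x (pd .x (pd .x (pd .x P)))
      + (C ((8 * α - 2 * β) * a (.u 0)) : MvPolynomial Coord 𝕜) • pd .x (pd .x P)
      - (C (20 * α * β * a (.u 0) ^ 2) : MvPolynomial Coord 𝕜) • P)
    + (6 : MvPolynomial Coord 𝕜) • v₀ 𝕜 • ((C (-2 * β) : MvPolynomial Coord 𝕜) • pd .x (pd .x P)
      + ⁅P, pd .x (pd .x (pd .x P))⁆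
      + (C ((8 * α - 2 * β) * a (.u 0)) : MvPolynomial Coord 𝕜) • ⁅P, pd .x P⁆
      - (C (40 * α * β * a (.u 0)) : MvPolynomial Coord 𝕜) • P)
    + (6 : MvPolynomial Coord 𝕜) • v₀ 𝕜 • v₀ 𝕜 • ((C (-2 * β) : MvPolynomial Coord 𝕜) • ⁅P, pd .x P⁆
      - (C (20 * α * β) : MvPolynomial Coord 𝕜) • P) := by
  have hn (n : ℕ) [n.AtLeastTwo] (f : LieSeries L) :
      pd (.u 0) ((OfNat.ofNat n : MvPolynomial Coord 𝕜) • f)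
        = (OfNat.ofNat n : MvPolynomial Coord 𝕜) • pd (.u 0) f := by
    rw [← map_ofNat C, pd_poly_smul, pderiv_C, zero_smul, zero_add]
  have hP1 := hP.pd .x
  have hP2 := hP1.pd .x
  have hP3 := hP2.pd .x
  have hP4 := hP3.pd .x
  rw [explicitB]
  simp only [map_add, map_sub, hn, pd_poly_smul, pderiv_uAt, pderiv_C, pderiv_X_self, pd_lie,
    hP 0, hP1 0, hP2 0, hP3 0, hP4 0, zero_lie, lie_zero, smul_zero, zero_smul, zero_add, add_zero]
  norm_num
  simp only [map_ofNat]
  module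

theorem pd_explicitB_succ (hP : UFree P) {k : ℕ} (hk : 1 ≤ k) : pd (.u k) (explicitB α β a P) =
    (if k = 4 then (6 : MvPolynomial Coord 𝕜) • P else 0)
    - (if k = 3 then (6 : MvPolynomial Coord 𝕜) • pd .x P else 0)
    + (if k = 2 then (6 : MvPolynomial Coord 𝕜) • (pd .x (pd .x P) + v₀ 𝕜 • ⁅P, pd .x P⁆
      + (C (8 * α - 2 * β) : MvPolynomial Coord 𝕜) • uAt a 0 • P) else 0)
    - (if k = 1 then (6 : MvPolynomial Coord 𝕜) • (pd .x (pd .x (pd .x P))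
      - (C (8 * α) : MvPolynomial Coord 𝕜) • v₀ 𝕜 • pd .x P
      + (C (8 * α - 2 * β) : MvPolynomial Coord 𝕜) • uAt a 0 • pd .x P)
      + (6 : MvPolynomial Coord 𝕜) • uAt a 1 • (⁅P, pd .x P⁆
        + (C (4 * α + 4 * β) : MvPolynomial Coord 𝕜) • P) else 0) := by
  have hn (n : ℕ) [n.AtLeastTwo] (f : LieSeries L) :
      pd (.u k) ((OfNat.ofNat n : MvPolynomial Coord 𝕜) • f)
        = (OfNat.ofNat n : MvPolynomial Coord 𝕜) • pd (.u k) f := by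
    rw [← map_ofNat C, pd_poly_smul, pderiv_C, zero_smul, zero_add]
  have hP1 := hP.pd .x
  have hP2 := hP1.pd .x
  have hP3 := hP2.pd .x
  have hP4 := hP3.pd .x
  have hX : pderiv (.u k) (v₀ 𝕜) = 0 := pderiv_X_of_ne (by simp; omega)
  have hU : pderiv (.u k) (uAt a 0) = 0 := by rw [pderiv_uAt, if_neg (by omega)]
  rw [explicitB]
  simp only [map_add, map_sub, hn, pd_poly_smul, hX, hU, pderiv_C, pd_lie,
    hP k, hP1 k, hP2 k, hP3 k, hP4 k, zero_lie, lie_zero, smul_zero, zero_smul,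
    add_zero, sub_zero]
  simp only [pderiv_uAt]
  split_ifs <;> first | omega | module

end Forward

end EvolutionEquation

end

/-! ### Every normalized solution has the explicit form. -/

noncomputable section

namespace EvolutionEquation

open MvPolynomial LieSeries

section Decomposition

variable {𝕜 : Type*} [Field 𝕜] [CharZero 𝕜] {L : Type*} [LieRing L] [LieAlgebra 𝕜 L]

variable {α β : 𝕜} {a : Coord → 𝕜} {A B : LieSeries L}

/-- As `A'' = 0` and `A` vanishes at `u_k = a_k`, the coefficient `P` is `A'`. Integrating the
formulas of `pd_B` determines `B` up to a series in `x, t`. -/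
theorem FordyZCR.exists_decomposition (hZ : FordyZCR α β a A B)
    (hA : ∀ k, 1 ≤ k → pd (.u k) A = 0) (hB : ∀ k, 5 ≤ k → pd (.u k) B = 0)
    (hA0 : ∀ m, NoU m → A.coeff m = 0) (h₂ : 6 * α + β ≠ 0) :
    ∃ P b : LieSeries L, UFree P ∧ UFree b ∧ A = v₀ 𝕜 • P ∧
      (6 : MvPolynomial Coord 𝕜) • B = explicitB α β a P + (6 : MvPolynomial Coord 𝕜) • b ∧
      ⁅P, pd .x (pd .x P)⁆ = (C (-4 * α) : MvPolynomial Coord 𝕜) • pd .x P ∧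
      ⁅P, ⁅P, pd .x P⁆⁆ = 0 := by
  have hA'' := hZ.pd_pd_A hA hB h₂
  obtain ⟨b4, b3, b2, b1, b0⟩ := hZ.pd_B hA hB
  set P := pd (.u 0) A with hPdef
  have hP : UFree P := by
    intro k
    rcases Nat.eq_zero_or_pos k with rfl | hk
    · exact hA''
    · rw [hPdef, pd_comm, hA k hk, map_zero]
  have hAP : A = v₀ 𝕜 • P := by
    rw [← sub_eq_zero]
    refine eq_zero_of_pd_u_eq_zero 𝕜 ?_ ?_
    · intro k
      rw [map_sub, pd_poly_smul, hP k, smul_zero, add_zero]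
      rcases Nat.eq_zero_or_pos k with rfl | hk
      · rw [pderiv_X_self, one_smul, ← hPdef, sub_self]
      · rw [hA k hk, pderiv_X_of_ne (by simp; omega), zero_smul, sub_zero]
    · intro m hm
      rw [LieSeries.coeff_sub, hA0 m hm, coeff_X_smul_of_eq_zero (hm 0), sub_zero]
  have hP1 := hP.pd .x
  have hP2 := hP1.pd .x
  have hP3 := hP2.pd .x
  have hd (f : LieSeries L) (hf : UFree f) : covDx a A f = pd .x f + v₀ 𝕜 • ⁅P, f⁆ := by
    rw [hAP]; exact hf.covDx_eq a P
  have hU (k : ℕ) (hk : k < 5) (f : LieSeries L) := covDx_uAt_smul a A f hk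
  have hV (f : LieSeries L) := covDx_X_smul a A f
  have h0 : uAt a 0 = v₀ 𝕜 + C (a (.u 0)) := rfl
  -- `B` and its derivatives in terms of `P`
  rw [hd P hP, lie_self, smul_zero, add_zero] at b3 b2
  rw [hd _ hP1] at b2
  have c2 : covDx a A (pd (.u 2) B) = (C (8 * α - 2 * β) : MvPolynomial Coord 𝕜) • (uAt a 1 • P
      + uAt a 0 • pd .x P) + pd .x (pd .x (pd .x P))
      + (2 : MvPolynomial Coord 𝕜) • v₀ 𝕜 • ⁅P, pd .x (pd .x P)⁆ + uAt a 1 • ⁅P, pd .x P⁆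
      + v₀ 𝕜 • v₀ 𝕜 • ⁅P, ⁅P, pd .x P⁆⁆ := by
    rw [b2]
    simp only [covDx_add, covDx_C_smul, hU 0 (by norm_num), hV, hd P hP, hd _ hP2,
      hd _ (hP.lie hP1), lie_self, pd_lie, smul_zero, add_zero, zero_add]
    module
  rw [c2] at b1
  have b11 : pd (.u 1) (pd (.u 1) B)
      = (C (-4 * α - 4 * β) : MvPolynomial Coord 𝕜) • P - ⁅P, pd .x P⁆ := by
    rw [b1]
    simp only [map_add, map_sub, pd_poly_smul, pderiv_uAt, pderiv_C, pd_lie, hP 1, hP1 1, hP2 1,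
      hP3 1, zero_lie, lie_zero, smul_zero, zero_smul, zero_add, add_zero, ← map_ofNat C 2]
    norm_num
    simp only [map_ofNat]
    module
  have b01 : pd (.u 0) (pd (.u 1) B) = -((C (8 * α - 2 * β) : MvPolynomial Coord 𝕜) • pd .x P
      + (2 : MvPolynomial Coord 𝕜) • ⁅P, pd .x (pd .x P)⁆
      + (2 : MvPolynomial Coord 𝕜) • v₀ 𝕜 • ⁅P, ⁅P, pd .x P⁆⁆) := by
    rw [b1]
    simp only [map_add, map_sub, pd_poly_smul, pderiv_uAt, pderiv_C, pd_lie, hP 0, hP1 0, hP2 0,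
      hP3 0, zero_lie, lie_zero, smul_zero, zero_smul, zero_add, add_zero, ← map_ofNat C 2,
      pderiv_X_self]
    norm_num
    simp only [map_ofNat]
    module
  -- The integrability condition between `u_0` and `u_1`; its coefficients in powers of `u_0 - a_0`
  -- are the relations `r₁` and `r₂`.
  have rel : (2 : MvPolynomial Coord 𝕜) • pd (.u 0) (pd (.u 1) B)
      = -covDx a A (pd (.u 1) (pd (.u 1) B)) := by
    have h := congrArg (pd (.u 1)) b0
    rw [pd_comm, map_sub, pd_succ_covDx a A _ (by norm_num : 0 < 5), hA 1 le_rfl] at h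
    simp only [map_sub, pd_poly_smul, pderiv_uAt, pderiv_C, hP 1] at h
    norm_num at h
    linear_combination (norm := module) h
  rw [b11, b01, covDx_sub, covDx_C_smul, hd _ hP, hd _ (hP.lie hP1), pd_lie, lie_self] at rel
  have r₁₂ := UFree.cubic_eq_zero (𝕜 := 𝕜)
    (f₀ := (C (-20 * α) : MvPolynomial Coord 𝕜) • pd .x P
      - (C 5 : MvPolynomial Coord 𝕜) • ⁅P, pd .x (pd .x P)⁆)
    (f₁ := (C (-5) : MvPolynomial Coord 𝕜) • ⁅P, ⁅P, pd .x P⁆⁆) (f₂ := 0)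
    ((hP1.C_smul _).sub ((hP.lie hP2).C_smul _)) ((hP.lie (hP.lie hP1)).C_smul _)
    (fun k => map_zero _) (by
      rw [lie_self] at rel
      simp only [map_sub, map_mul, map_neg, map_ofNat] at rel ⊢
      linear_combination (norm := module) rel)
  have r₁ : ⁅P, pd .x (pd .x P)⁆ = (C (-4 * α) : MvPolynomial Coord 𝕜) • pd .x P := by
    have h := r₁₂.1
    refine sub_eq_zero.mp (eq_zero_of_ofNat_smul (𝕜 := 𝕜) 5 ?_)
    simp only [map_mul, map_neg, map_ofNat] at h ⊢
    linear_combination (norm := module) -h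
  have r₂ : ⁅P, ⁅P, pd .x P⁆⁆ = 0 := eq_zero_of_C_smul (by norm_num) r₁₂.2.1
  rw [r₁, r₂] at b1
  have c1 := congrArg (covDx a A) b1
  simp only [covDx_add, covDx_sub, covDx_C_smul, hU 1 (by norm_num), hU 0 (by norm_num), hV,
    hd P hP, hd _ hP1, hd _ hP3, hd _ (hP.lie hP1), lie_self, pd_lie, smul_zero, add_zero,
    zero_add, ← map_ofNat C 2, r₁, r₂] at c1
  rw [c1] at b0
  have hb6 (y : LieSeries L) : (6 : MvPolynomial Coord 𝕜) • (C 6⁻¹ : MvPolynomial Coord 𝕜) • y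
      = y := by
    rw [← map_ofNat C, smul_smul, ← C_mul]
    simp
  have hn (k n : ℕ) [n.AtLeastTwo] (f : LieSeries L) :
      pd (.u k) ((OfNat.ofNat n : MvPolynomial Coord 𝕜) • f)
        = (OfNat.ofNat n : MvPolynomial Coord 𝕜) • pd (.u k) f := by
    rw [← map_ofNat C, pd_poly_smul, pderiv_C, zero_smul, zero_add]
  refine ⟨P, (C 6⁻¹ : MvPolynomial Coord 𝕜) • ((6 : MvPolynomial Coord 𝕜) • B
    - explicitB α β a P), hP, ?_, hAP, ?_, r₁, r₂⟩
  · refine UFree.C_smul (fun k => ?_) _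
    rw [map_sub, hn]
    rcases Nat.eq_zero_or_pos k with rfl | hk
    · rw [pd_explicitB_zero hP, b0, h0]
      simp only [map_sub, map_mul, map_neg, map_ofNat, map_pow]
      module
    · rw [pd_explicitB_succ hP hk]
      by_cases h5 : 5 ≤ k
      · rw [hB k h5, if_neg (by omega), if_neg (by omega), if_neg (by omega), if_neg (by omega)]
        simp
      · interval_cases k
        · rw [b1]
          simp only [map_sub, map_add, map_mul, map_neg, map_ofNat]
          norm_num
          module
        · rw [b2]
          norm_num
          module
        · rw [b3]
          norm_num
        · rw [b4]
          norm_num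
  · rw [hb6]; abel

end Decomposition

end EvolutionEquation

end

/-! ### Initial values at `x = x_a`, and series with coefficients in a subalgebra. -/

noncomputable section

namespace EvolutionEquation

open MvPolynomial LieSeries Finset.HasAntidiagonal

section InitialValue

variable (𝕜 : Type*) [Field 𝕜] (L : Type*) [LieRing L] [LieAlgebra 𝕜 L]

/-- The series which vanish on `x = x_a`, `u_k = a_k`, `k ≥ 0`. -/
def initNull : Submodule (MvPolynomial Coord 𝕜) (LieSeries L) where
  carrier := {f | ∀ m, m .x = 0 → NoU m → f.coeff m = 0}
  zero_mem' := fun m _ _ => rfl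
  add_mem' := fun hf hg m hm hm' => by rw [LieSeries.coeff_add, hf m hm hm', hg m hm hm', add_zero]
  smul_mem' := fun g f hf m hm hm' => by
    rw [coeff_poly_smul]
    refine Finset.sum_eq_zero fun p hp => ?_
    rw [mem_antidiagonal] at hp
    rw [hf p.2, smul_zero]
    · rw [← hp] at hm; simp at hm; exact hm.2
    · intro k
      have := hm' k
      rw [← hp] at this; simp at this; exact this.2

variable {𝕜 L}

theorem X_smul_mem_initNull (k : ℕ) (f : LieSeries L) :
    (X (.u k) : MvPolynomial Coord 𝕜) • f ∈ initNull 𝕜 L :=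
  fun _ _ hm' => coeff_X_smul_of_eq_zero (hm' k) f

theorem lie_mem_initNull (g : LieSeries L) {f : LieSeries L} (hf : f ∈ initNull 𝕜 L) :
    ⁅g, f⁆ ∈ initNull 𝕜 L := fun m hm hm' => by
  rw [coeff_lie]
  refine Finset.sum_eq_zero fun p hp => ?_
  rw [mem_antidiagonal] at hp
  rw [hf p.2, lie_zero]
  · rw [← hp] at hm; simp at hm; exact hm.2
  · intro k
    have := hm' k
    rw [← hp] at this; simp at this; exact this.2

theorem pd_t_mem_initNull {f : LieSeries L} (hf : f ∈ initNull 𝕜 L) :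
    pd .t f ∈ initNull 𝕜 L := fun m hm hm' => by
  rw [coeff_pd, hf, smul_zero]
  · simpa using hm
  · intro k; simpa using hm' k

theorem eq_zero_of_mem_initNull [CharZero 𝕜] {f : LieSeries L} (hf : f ∈ initNull 𝕜 L)
    (hu : UFree f) (hx : pd .x f = 0) : f = 0 :=
  eq_zero_of_pd_u_eq_zero 𝕜 hu fun m hm => by
    by_cases h : m .x = 0
    · exact hf m h hm
    · exact coeff_eq_zero_of_pd_eq_zero 𝕜 hx h

/-- The subtracted series is `explicitB` with every `u_k` replaced by `a_k`, simplified by `h₃`; the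
difference is a sum of multiples of the `X (.u k)`. -/
theorem explicitB_sub_mem_initNull (α β : 𝕜) (a : Coord → 𝕜) (P : LieSeries L)
    (h₃ : pd .x (pd .x (pd .x P)) = (-8 * α * a (.u 0)) • pd .x P) :
    explicitB α β a P - ((6 * a (.u 4) + 6 * a (.u 2) * (8 * α - 2 * β) * a (.u 0)
        - 12 * β * a (.u 1) ^ 2) • P
      + (12 * β * a (.u 0) * a (.u 1) - 6 * a (.u 3)) • pd .x P
      + (6 * a (.u 2)) • pd .x (pd .x P)
      + (-3 * a (.u 1) ^ 2) • (⁅P, pd .x P⁆ + (4 * α) • P)) ∈ initNull 𝕜 L := by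
  have h : explicitB α β a P - ((6 * a (.u 4) + 6 * a (.u 2) * (8 * α - 2 * β) * a (.u 0)
        - 12 * β * a (.u 1) ^ 2) • P
      + (12 * β * a (.u 0) * a (.u 1) - 6 * a (.u 3)) • pd .x P
      + (6 * a (.u 2)) • pd .x (pd .x P)
      + (-3 * a (.u 1) ^ 2) • (⁅P, pd .x P⁆ + (4 * α) • P))
    = (X (.u 4) : MvPolynomial Coord 𝕜) • (6 : MvPolynomial Coord 𝕜) • P
      - (X (.u 3) : MvPolynomial Coord 𝕜) • (6 : MvPolynomial Coord 𝕜) • pd .x P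
      + (X (.u 2) : MvPolynomial Coord 𝕜) • (6 : MvPolynomial Coord 𝕜) •
        (pd .x (pd .x P) + v₀ 𝕜 • ⁅P, pd .x P⁆
          + (C (8 * α - 2 * β) : MvPolynomial Coord 𝕜) • uAt a 0 • P)
      - (X (.u 1) : MvPolynomial Coord 𝕜) • ((6 : MvPolynomial Coord 𝕜) • (pd .x (pd .x (pd .x P))
          - (C (8 * α) : MvPolynomial Coord 𝕜) • v₀ 𝕜 • pd .x P
          + (C (8 * α - 2 * β) : MvPolynomial Coord 𝕜) • uAt a 0 • pd .x P)
        + (3 : MvPolynomial Coord 𝕜) • (uAt a 1 + C (a (.u 1))) • (⁅P, pd .x P⁆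
          + (C (4 * α + 4 * β) : MvPolynomial Coord 𝕜) • P))
      + (X (.u 0) : MvPolynomial Coord 𝕜) • ((6 : MvPolynomial Coord 𝕜) •
          (C (a (.u 2)) : MvPolynomial Coord 𝕜) • (⁅P, pd .x P⁆
            + (C (8 * α - 2 * β) : MvPolynomial Coord 𝕜) • P)
        + (6 : MvPolynomial Coord 𝕜) • (C (2 * β * a (.u 1)) : MvPolynomial Coord 𝕜) • pd .x P
        + (6 : MvPolynomial Coord 𝕜) • (pd .x (pd .x (pd .x (pd .x P)))
          + (C ((8 * α - 2 * β) * a (.u 0)) : MvPolynomial Coord 𝕜) • pd .x (pd .x P)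
          - (C (20 * α * β * a (.u 0) ^ 2) : MvPolynomial Coord 𝕜) • P)
        + (3 : MvPolynomial Coord 𝕜) • v₀ 𝕜 •
          ((C (-2 * β) : MvPolynomial Coord 𝕜) • pd .x (pd .x P)
          + ⁅P, pd .x (pd .x (pd .x P))⁆
          + (C ((8 * α - 2 * β) * a (.u 0)) : MvPolynomial Coord 𝕜) • ⁅P, pd .x P⁆
          - (C (40 * α * β * a (.u 0)) : MvPolynomial Coord 𝕜) • P)
        + (2 : MvPolynomial Coord 𝕜) • v₀ 𝕜 • v₀ 𝕜 •
          ((C (-2 * β) : MvPolynomial Coord 𝕜) • ⁅P, pd .x P⁆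
          - (C (20 * α * β) : MvPolynomial Coord 𝕜) • P)) := by
    rw [explicitB, h₃]
    simp only [← C_smul, uAt]
    simp only [map_sub, map_mul, map_add, map_neg, map_ofNat, map_pow]
    module
  rw [h]
  refine add_mem (sub_mem (add_mem (sub_mem ?_ ?_) ?_) ?_) ?_ <;> exact X_smul_mem_initNull _ _

end InitialValue

section Coefficients

variable {𝕜 : Type*} [Field 𝕜] {L : Type*} [LieRing L] [LieAlgebra 𝕜 L]

/-- The series with coefficients in a Lie subalgebra. -/
def coeffsIn (I : LieSubalgebra 𝕜 L) : Submodule (MvPolynomial Coord 𝕜) (LieSeries L) where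
  carrier := {f | ∀ m, f.coeff m ∈ I}
  zero_mem' := fun m => I.zero_mem
  add_mem' := fun hf hg m => I.add_mem (hf m) (hg m)
  smul_mem' := fun g f hf m => by
    rw [coeff_poly_smul]
    exact I.toSubmodule.sum_mem fun p _ => I.smul_mem _ (hf p.2)

theorem lie_mem_coeffsIn {I : LieSubalgebra 𝕜 L} {f g : LieSeries L} (hf : f ∈ coeffsIn I)
    (hg : g ∈ coeffsIn I) : ⁅f, g⁆ ∈ coeffsIn I := fun m => by
  rw [coeff_lie]
  exact I.toSubmodule.sum_mem fun p _ => I.lie_mem (hf p.1) (hg p.2)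

theorem pd_mem_coeffsIn {I : LieSubalgebra 𝕜 L} {f : LieSeries L} (hf : f ∈ coeffsIn I)
    (v : Coord) : pd v f ∈ coeffsIn I := fun m => by
  rw [coeff_pd]
  exact I.toSubmodule.smul_of_tower_mem _ (hf _)

theorem explicitB_mem_coeffsIn {I : LieSubalgebra 𝕜 L} (α β : 𝕜) (a : Coord → 𝕜)
    {P : LieSeries L} (hP : P ∈ coeffsIn I) : explicitB α β a P ∈ coeffsIn I := by
  have h1 := pd_mem_coeffsIn hP .x
  have h2 := pd_mem_coeffsIn h1 .x
  have h3 := pd_mem_coeffsIn h2 .x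
  have h4 := pd_mem_coeffsIn h3 .x
  have hq := lie_mem_coeffsIn hP h1
  have hq3 := lie_mem_coeffsIn hP h3
  rw [explicitB]
  repeat' first
    | assumption | apply add_mem | apply sub_mem | apply Submodule.smul_mem

/-- Suited to differential equations: the coefficient at `m + Finsupp.single v 1` is fixed by the
coefficient of the `v`-derivative at `m`. -/
theorem monomial_induction {p : (Coord →₀ ℕ) → Prop} (h0 : p 0)
    (h : ∀ m v, p m → p (m + Finsupp.single v 1)) (m : Coord →₀ ℕ) : p m := by
  induction m using Finsupp.induction with
  | zero => exact h0
  | single_add v n f _ _ ih =>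
    clear * - ih h
    induction n with
    | zero => simpa using ih
    | succ n ihn =>
      rw [Finsupp.single_add, add_right_comm]
      exact h _ _ ihn

theorem coeff_eq_zero_of_const (𝕜 : Type*) [Field 𝕜] [CharZero 𝕜] {L : Type*} [LieRing L]
    [LieAlgebra 𝕜 L] {J : LieSeries L} (hu : UFree J) (hx : pd .x J = 0)
    (ht : pd .t J = 0) {m : Coord →₀ ℕ} (hm : m ≠ 0) : J.coeff m = 0 := by
  obtain ⟨v, hv⟩ := Finsupp.ne_iff.mp hm
  cases v with
  | x => exact coeff_eq_zero_of_pd_eq_zero 𝕜 hx hv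
  | t => exact coeff_eq_zero_of_pd_eq_zero 𝕜 ht hv
  | u k => exact coeff_eq_zero_of_pd_eq_zero 𝕜 (hu k) hv

theorem coeff_const_lie {J f : LieSeries L} (hJ : ∀ m ≠ 0, J.coeff m = 0) (m : Coord →₀ ℕ) :
    ⁅J, f⁆.coeff m = ⁅J.coeff 0, f.coeff m⁆ := by
  rw [coeff_lie, Finset.sum_eq_single (0, m)]
  · rintro ⟨i, j⟩ h h'
    rw [mem_antidiagonal] at h
    rw [hJ, zero_lie]
    rintro rfl
    simp at h
    exact h' (by rw [h])
  · simp

theorem coeff_succ_mem [CharZero 𝕜] {I : LieSubalgebra 𝕜 L} {f g : LieSeries L} {v : Coord}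
    (h : pd v f = g) {m : Coord →₀ ℕ} (hg : g.coeff m ∈ I) :
    f.coeff (m + Finsupp.single v 1) ∈ I := by
  rw [← h, coeff_pd, ← Nat.cast_smul_eq_nsmul 𝕜] at hg
  exact (I.toSubmodule.smul_mem_iff (Nat.cast_ne_zero.mpr (Nat.succ_ne_zero _))).mp hg

end Coefficients

end EvolutionEquation

end

/-! ### Four elements span all coefficients. -/

noncomputable section

namespace EvolutionEquation

open MvPolynomial LieSeries

section Generation

variable {𝕜 : Type*} [Field 𝕜] [CharZero 𝕜] {L : Type*} [LieRing L] [LieAlgebra 𝕜 L]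

variable {α β : 𝕜} {a : Coord → 𝕜} {A B : LieSeries L}

/-- The brackets of the elements `∂ₓⁱP(a)`, `i = 0, 1, 2`, and of the central element `K`. -/
structure FordyBasis (α s : 𝕜) (p₀ p₁ p₂ K : L) : Prop where
  lie₀₁ : ⁅p₀, p₁⁆ = K - (4 * α) • p₀
  lie₀₂ : ⁅p₀, p₂⁆ = (-4 * α) • p₁
  lie₁₂ : ⁅p₁, p₂⁆ = (-4 * α) • p₂ + (8 * α * s) • (K - (4 * α) • p₀)
  lie₀ : ⁅p₀, K⁆ = 0
  lie₁ : ⁅p₁, K⁆ = 0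
  lie₂ : ⁅p₂, K⁆ = 0

namespace FordyBasis

variable {s : 𝕜} {p₀ p₁ p₂ K : L}

/-- The span of the elements of a Fordy basis is a Lie subalgebra. -/
def subalgebra (h : FordyBasis α s p₀ p₁ p₂ K) : LieSubalgebra 𝕜 L where
  toSubmodule := Submodule.span 𝕜 {p₀, p₁, p₂, K}
  lie_mem' := by
    intro x y hx hy
    have m₀ : p₀ ∈ Submodule.span 𝕜 {p₀, p₁, p₂, K} := Submodule.subset_span (by simp)
    have m₁ : p₁ ∈ Submodule.span 𝕜 {p₀, p₁, p₂, K} := Submodule.subset_span (by simp)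
    have m₂ : p₂ ∈ Submodule.span 𝕜 {p₀, p₁, p₂, K} := Submodule.subset_span (by simp)
    have m₃ : K ∈ Submodule.span 𝕜 {p₀, p₁, p₂, K} := Submodule.subset_span (by simp)
    have q₀₁ : ⁅p₀, p₁⁆ ∈ Submodule.span 𝕜 {p₀, p₁, p₂, K} := by
      rw [h.lie₀₁]; exact sub_mem m₃ (Submodule.smul_mem _ _ m₀)
    have q₀₂ : ⁅p₀, p₂⁆ ∈ Submodule.span 𝕜 {p₀, p₁, p₂, K} := by
      rw [h.lie₀₂]; exact Submodule.smul_mem _ _ m₁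
    have q₁₂ : ⁅p₁, p₂⁆ ∈ Submodule.span 𝕜 {p₀, p₁, p₂, K} := by
      rw [h.lie₁₂]
      exact add_mem (Submodule.smul_mem _ _ m₂)
        (Submodule.smul_mem _ _ (sub_mem m₃ (Submodule.smul_mem _ _ m₀)))
    have skew {x y : L} (h : ⁅x, y⁆ ∈ Submodule.span 𝕜 {p₀, p₁, p₂, K}) :
        ⁅y, x⁆ ∈ Submodule.span 𝕜 {p₀, p₁, p₂, K} := by
      rw [← lie_skew]; exact neg_mem h
    have zero {x : L} (h : x = 0) : x ∈ Submodule.span 𝕜 {p₀, p₁, p₂, K} := h ▸ zero_mem _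
    have key (u v : L) (hu : u ∈ ({p₀, p₁, p₂, K} : Set L))
        (hv : v ∈ ({p₀, p₁, p₂, K} : Set L)) : ⁅u, v⁆ ∈ Submodule.span 𝕜 {p₀, p₁, p₂, K} := by
      simp only [Set.mem_insert_iff, Set.mem_singleton_iff] at hu hv
      rcases hu with rfl | rfl | rfl | rfl <;> rcases hv with rfl | rfl | rfl | rfl <;>
        first
        | assumption
        | exact zero (lie_self _)
        | exact zero h.lie₀
        | exact zero h.lie₁
        | exact zero h.lie₂
        | exact skew (zero h.lie₀)
        | exact skew (zero h.lie₁)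
        | exact skew (zero h.lie₂)
        | exact skew ‹_›
    change ⁅x, y⁆ ∈ Submodule.span 𝕜 {p₀, p₁, p₂, K}
    replace hx : x ∈ Submodule.span 𝕜 {p₀, p₁, p₂, K} := hx
    replace hy : y ∈ Submodule.span 𝕜 {p₀, p₁, p₂, K} := hy
    induction hx using Submodule.span_induction with
    | zero => rw [zero_lie]; exact zero_mem _
    | add u v _ _ hu hv => rw [add_lie]; exact add_mem hu hv
    | smul r u _ hu => rw [smul_lie]; exact Submodule.smul_mem _ _ hu
    | mem u hu =>
      induction hy using Submodule.span_induction with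
      | zero => rw [lie_zero]; exact zero_mem _
      | add v w _ _ hv hw => rw [lie_add]; exact add_mem hv hw
      | smul r v _ hv => rw [lie_smul]; exact Submodule.smul_mem _ _ hv
      | mem v hv => exact key u v hu hv

end FordyBasis

/-- The coefficients of a solution of the zero-curvature equation for Fordy's equation lie in the
span of four elements. -/
theorem FordyZCR.exists_fordyBasis (h₁ : α + β ≠ 0) (h₂ : 6 * α + β ≠ 0)
    (h₃ : 16 * α + β ≠ 0) (hZ : FordyZCR α β a A B)
    (hA : ∀ k, 1 ≤ k → pd (.u k) A = 0) (hB : ∀ k, 5 ≤ k → pd (.u k) B = 0)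
    (hA0 : ∀ m, NoU m → A.coeff m = 0) (hB0 : B ∈ initNull 𝕜 L) :
    ∃ (P : LieSeries L) (K : L), A = v₀ 𝕜 • P ∧ UFree P ∧ ∃ h : FordyBasis α (a (.u 0)) (P.coeff 0)
      ((pd .x P).coeff 0) ((pd .x (pd .x P)).coeff 0) K,
      A ∈ coeffsIn h.subalgebra ∧ B ∈ coeffsIn h.subalgebra := by
  obtain ⟨P, b, hP, hb, rfl, hBE, r₁, r₂⟩ := hZ.exists_decomposition hA hB hA0 h₂
  obtain ⟨hbx, r₄, r₃⟩ := (fordyZCR_iff hP hb r₁ r₂ hBE).mp hZ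
  let δ : LieSeries L →ₗ[𝕜] LieSeries L :=
    { toFun := pd .x, map_add' := map_add _, map_smul' := fun r f => pd_smul _ r f }
  let D : LieSeries L →ₗ[𝕜] LieSeries L :=
    { toFun := fun f => pd .t f + ⁅b, f⁆
      map_add' := fun f g => by rw [map_add, lie_add]; abel
      map_smul' := fun r f => by rw [pd_smul, lie_smul, smul_add]; rfl }
  set s := a (.u 0) with hs
  rw [C_smul] at r₁
  obtain ⟨hP3, hDP, hP12, hKx, hDK, hPK, hP1K, hP2K⟩ := fordy_relations (α := α) (β := β) s
    h₁ h₂ h₃ δ D (fun f g => pd_lie _ f g)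
    (fun f g => by
      change pd .t ⁅f, g⁆ + ⁅b, ⁅f, g⁆⁆ = ⁅pd .t f + ⁅b, f⁆, g⁆ + ⁅f, pd .t g + ⁅b, g⁆⁆
      rw [pd_lie, add_lie, lie_add, leibniz_lie b f g]; abel)
    (fun f => by
      change pd .t (pd .x f) + ⁅b, pd .x f⁆ = pd .x (pd .t f + ⁅b, f⁆)
      rw [map_add, pd_lie, hbx, zero_lie, zero_add, pd_comm])
    P r₁ r₂ r₃ r₄
  simp only [δ, D, LinearMap.coe_mk, AddHom.coe_mk] at hP3 hDP hP12 hKx hDK hPK hP1K hP2K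
  set P₁ := pd .x P with hP₁
  set P₂ := pd .x P₁ with hP₂
  set K := ⁅P, P₁⁆ + (4 * α) • P with hK
  have uP₁ : UFree P₁ := hP.pd _
  have uP₂ : UFree P₂ := uP₁.pd _
  have uK : UFree K := (hP.lie uP₁).add (hP.smul _)
  have hPP₁ : ⁅P, P₁⁆ = K - (4 * α) • P := by rw [hK]; abel
  set W := P₂ + (8 * α * s) • P with hW
  -- Since `⁅W, P⁆ = 4α P₁`, the formula for `D P` becomes `P_t = ⁅J, P⁆`; and `W` and `b` do not
  -- depend on `x`, so neither does `J`.
  set J := (-β * s ^ 2) • W - b with hJ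
  have hWx : pd .x W = 0 := by rw [hW, map_add, pd_smul, hP3, ← hP₁]; module
  have hJx : pd .x J = 0 := by rw [hJ, map_sub, pd_smul, hWx, hbx]; simp
  have uW : UFree W := uP₂.add (hP.smul _)
  have uJ : UFree J := (uW.smul _).sub hb
  have hPt : pd .t P = ⁅J, P⁆ := by
    rw [hJ, sub_lie, smul_lie, hW, add_lie, smul_lie, lie_self, ← lie_skew, r₁]
    linear_combination (norm := module) hDP
  have hP₁t : pd .t P₁ = ⁅J, P₁⁆ := by
    rw [hP₁, pd_comm, hPt, pd_lie, hJx, zero_lie, zero_add]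
  have hP₂t : pd .t P₂ = ⁅J, P₂⁆ := by
    rw [hP₂, pd_comm, hP₁t, pd_lie, hJx, zero_lie, zero_add]
  have hWt : pd .t W = ⁅J, W⁆ := by
    rw [hW, map_add, pd_smul, hP₂t, hPt, lie_add, lie_smul]
  have hKt : pd .t K = ⁅J, K⁆ := by
    rw [hK, map_add, pd_smul, pd_lie, hPt, hP₁t, lie_add, lie_smul, leibniz_lie J P P₁]
  -- the value of `B` at `u_k = a_k`
  set c₀ := 6 * a (.u 4) + 6 * a (.u 2) * (8 * α - 2 * β) * s - 12 * β * a (.u 1) ^ 2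
  set c₁ := 12 * β * s * a (.u 1) - 6 * a (.u 3)
  set c₂ := 6 * a (.u 2)
  set c₃ := -3 * a (.u 1) ^ 2
  set Θ := c₀ • P + c₁ • P₁ + c₂ • P₂ + c₃ • K with hΘ
  have hΘt : pd .t Θ = ⁅J, Θ⁆ := by
    simp only [hΘ, map_add, pd_smul, lie_add, lie_smul, hPt, hP₁t, hP₂t, hKt]
  -- The normalization of `B` says that `6b = -Θ` at `x = x_a`. As `b` is independent of `x`,
  -- identities for `Θ` pass to `b` through `cancel6`.
  have hnull : Θ + (6 : MvPolynomial Coord 𝕜) • b ∈ initNull 𝕜 L := by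
    have h1 := explicitB_sub_mem_initNull α β a P hP3
    have h2 : Θ + (6 : MvPolynomial Coord 𝕜) • b = (6 : MvPolynomial Coord 𝕜) • B
        - (explicitB α β a P - Θ) := by rw [hBE]; abel
    rw [h2]
    exact sub_mem (Submodule.smul_mem _ _ hB0) h1
  have h6 : (6 : MvPolynomial Coord 𝕜) • b = (6 : 𝕜) • b := by rw [← C_smul, map_ofNat]
  rw [h6] at hnull
  have cancel6 {f : LieSeries L} (hu : UFree f) (hx : pd .x f = 0)
      (hf : (6 : 𝕜) • f ∈ initNull 𝕜 L) : f = 0 := by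
    have := eq_zero_of_mem_initNull hf (hu.smul _) (by rw [pd_smul, hx, smul_zero])
    exact (smul_eq_zero.mp this).resolve_left (by norm_num)
  have hbt : pd .t b = ⁅J, b⁆ := by
    rw [← sub_eq_zero]
    refine cancel6 ((hb.pd _).sub (uJ.lie hb)) ?_ ?_
    · rw [map_sub, pd_comm, hbx, pd_lie, hJx, hbx]; simp
    · have h := sub_mem (pd_t_mem_initNull hnull) (lie_mem_initNull J hnull)
      rw [map_add (pd .t) Θ, pd_smul, hΘt, lie_add J Θ, lie_smul] at h
      convert h using 1
      module
  -- Both `W` and `b` evolve by `ad J`, hence so does `J`, and `⁅J, J⁆ = 0`.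
  have hJt : pd .t J = 0 := by
    have h : pd .t J = ⁅J, J⁆ := by
      conv_rhs => rw [hJ, ← hJ, hJ]
      rw [← hJ, lie_sub, lie_smul, hJ, map_sub, pd_smul, hWt, hbt, ← hJ]
    rw [h, lie_self]
  -- `K` commutes with `Θ`, hence with `b`; then `D K = 0` reduces to `K_t = 0`.
  have hbK : ⁅K, b⁆ = 0 := by
    refine cancel6 (uK.lie hb) ?_ ?_
    · rw [pd_lie, hKx, hbx]; simp
    · have h := lie_mem_initNull K hnull
      have h0 : ⁅K, Θ⁆ = 0 := by
        rw [← lie_skew, hΘ]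
        simp [hPK, hP1K, hP2K]
      rwa [lie_add, h0, zero_add, lie_smul] at h
  have hKt0 : pd .t K = 0 := by
    have h : ⁅b, K⁆ = 0 := by rw [← lie_skew, hbK, neg_zero]
    rwa [h, add_zero] at hDK
  -- constants
  have cJ (m : Coord →₀ ℕ) (hm : m ≠ 0) : J.coeff m = 0 := coeff_eq_zero_of_const 𝕜 uJ hJx hJt hm
  have cK (m : Coord →₀ ℕ) (hm : m ≠ 0) : K.coeff m = 0 := coeff_eq_zero_of_const 𝕜 uK hKx hKt0 hm
  have z (f g : LieSeries L) : ⁅f, g⁆.coeff 0 = ⁅f.coeff 0, g.coeff 0⁆ := by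
    simp [coeff_lie]
  have hbasis : FordyBasis α s (P.coeff 0) (P₁.coeff 0) (P₂.coeff 0) (K.coeff 0) :=
    { lie₀₁ := by rw [← z, hPP₁]; simp
      lie₀₂ := by rw [← z, r₁]; simp
      lie₁₂ := by rw [← z, hP12, hPP₁]; simp
      lie₀ := by rw [← z, hPK]; simp
      lie₁ := by rw [← z, hP1K]; simp
      lie₂ := by rw [← z, hP2K]; simp }
  refine ⟨P, K.coeff 0, rfl, hP, hbasis, ?_⟩
  set I := hbasis.subalgebra with hI
  have m₀ : P.coeff 0 ∈ I := Submodule.subset_span (by simp)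
  have m₁ : P₁.coeff 0 ∈ I := Submodule.subset_span (by simp)
  have m₂ : P₂.coeff 0 ∈ I := Submodule.subset_span (by simp)
  have m₃ : K.coeff 0 ∈ I := Submodule.subset_span (by simp)
  have mb : b.coeff 0 ∈ I := by
    have h := hnull 0 rfl (fun _ => rfl)
    have h' : b.coeff 0 = (6⁻¹ : 𝕜) • -(c₀ • P.coeff 0 + c₁ • P₁.coeff 0 + c₂ • P₂.coeff 0
        + c₃ • K.coeff 0) := by
      simp only [hΘ, LieSeries.coeff_add, LieSeries.coeff_smul] at h
      rw [eq_inv_smul_iff₀ (by norm_num), eq_neg_iff_add_eq_zero, ← h]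
      abel
    rw [h']
    exact I.smul_mem _ (I.neg_mem (I.add_mem (I.add_mem (I.add_mem (I.smul_mem _ m₀)
      (I.smul_mem _ m₁)) (I.smul_mem _ m₂)) (I.smul_mem _ m₃)))
  have mJ : J.coeff 0 ∈ I := by
    simp only [hJ, hW, LieSeries.coeff_add, LieSeries.coeff_smul, LieSeries.coeff_sub]
    exact I.sub_mem (I.smul_mem _ (I.add_mem m₂ (I.smul_mem _ m₀))) mb
  -- The system is closed: `∂_x` sends `P, P₁, P₂` to `P₁, P₂` and a multiple of `P₁`, and `∂_t`
  -- acts as `ad J` with `J` constant in `I`.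
  have mP (m : Coord →₀ ℕ) : P.coeff m ∈ I ∧ P₁.coeff m ∈ I ∧ P₂.coeff m ∈ I := by
    induction m using monomial_induction with
    | h0 => exact ⟨m₀, m₁, m₂⟩
    | h m v ih =>
      obtain ⟨i₀, i₁, i₂⟩ := ih
      have ht {f : LieSeries L} (h : f.coeff m ∈ I) : ⁅J, f⁆.coeff m ∈ I := by
        rw [coeff_const_lie cJ]
        exact I.lie_mem mJ h
      cases v with
      | x =>
        refine ⟨coeff_succ_mem hP₁.symm i₁, coeff_succ_mem hP₂.symm i₂, coeff_succ_mem hP3 ?_⟩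
        exact I.smul_mem _ i₁
      | t => exact ⟨coeff_succ_mem hPt (ht i₀), coeff_succ_mem hP₁t (ht i₁),
          coeff_succ_mem hP₂t (ht i₂)⟩
      | u k => exact ⟨coeff_succ_mem (hP k) I.zero_mem, coeff_succ_mem (uP₁ k) I.zero_mem,
          coeff_succ_mem (uP₂ k) I.zero_mem⟩
  have cP : P ∈ coeffsIn I := fun m => (mP m).1
  have cP₂ : P₂ ∈ coeffsIn I := fun m => (mP m).2.2
  have cJI : J ∈ coeffsIn I := fun m => by
    by_cases hm : m = 0
    · rw [hm]; exact mJ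
    · rw [cJ m hm]; exact I.zero_mem
  have cb : b ∈ coeffsIn I := by
    have h : b = (C (-β * s ^ 2) : MvPolynomial Coord 𝕜) • (P₂
        + (C (8 * α * s) : MvPolynomial Coord 𝕜) • P) - J := by
      rw [C_smul, C_smul, ← hW, hJ]; abel
    rw [h]
    exact sub_mem (Submodule.smul_mem _ _ (add_mem cP₂ (Submodule.smul_mem _ _ cP))) cJI
  refine ⟨Submodule.smul_mem _ _ cP, ?_⟩
  have h : B = (C 6⁻¹ : MvPolynomial Coord 𝕜) • (explicitB α β a P
      + (6 : MvPolynomial Coord 𝕜) • b) := by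
    rw [← hBE, ← map_ofNat C, smul_smul, ← C_mul]
    simp
  rw [h]
  exact Submodule.smul_mem _ _ (add_mem (explicitB_mem_coeffsIn α β a cP)
    (Submodule.smul_mem _ _ cb))

end Generation

end EvolutionEquation

end

/-! ### Generation and the universal property of the algebra given by the relations. -/

noncomputable section

namespace EvolutionEquation

section Universal

variable {𝕜 : Type*} [Field 𝕜] {L M : Type*} [LieRing L] [LieAlgebra 𝕜 L] [LieRing M]
  [LieAlgebra 𝕜 M]

theorem map_zeroCurvature (φ : L →ₗ⁅𝕜⁆ M) (F : MvPolynomial Coord 𝕜) (a : Coord → 𝕜) (p q : ℕ)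
    (A B : FormalSeries L) (m : Coord →₀ ℕ) :
    φ (zeroCurvature F a p q A B m)
      = zeroCurvature F a p q (fun i => φ (A i)) (fun i => φ (B i)) m := by
  simp only [zeroCurvature, applyField, polyMul, partialDeriv, seriesBracket, map_add, map_sub,
    map_sum, map_smul, LieHom.map_lie, map_nsmul]

namespace FAlgebra

variable (F : MvPolynomial Coord 𝕜) (n p : ℕ) (a : Coord → 𝕜)

/-- The quotient map onto `𝔽^p(E, a)`. -/
def mk : FreeLieAlgebra 𝕜 Gen →ₗ⁅𝕜⁆ FAlgebra F n p a :=
  { (LieSubmodule.Quotient.mk' (LieSubmodule.lieSpan 𝕜 (FreeLieAlgebra 𝕜 Gen)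
      {r | Relation F n p a r}) : FreeLieAlgebra 𝕜 Gen →ₗ[𝕜] FAlgebra F n p a) with
    map_lie' := fun {x y} => LieSubmodule.Quotient.mk_bracket _ x y }

theorem mk_surjective : Function.Surjective (mk F n p a) :=
  LieSubmodule.Quotient.surjective_mk' _

variable {F n p a} in
theorem mk_eq_zero {r : FreeLieAlgebra 𝕜 Gen} (h : Relation F n p a r) : mk F n p a r = 0 :=
  LieSubmodule.Quotient.mk_eq_zero'.mpr (LieSubmodule.subset_lieSpan h)

/-- The series `A` with coefficients in `𝔽^p(E, a)`. -/
def seriesA : FormalSeries (FAlgebra F n p a) := fun m => mk F n p a (genericA 𝕜 m)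

/-- The series `B` with coefficients in `𝔽^p(E, a)`. -/
def seriesB : FormalSeries (FAlgebra F n p a) := fun m => mk F n p a (genericB 𝕜 m)

theorem zeroCurvature_series :
    zeroCurvature F a p (p + n - 1) (seriesA F n p a) (seriesB F n p a) = 0 := by
  funext m
  exact (map_zeroCurvature (mk F n p a) F a p (p + n - 1) (genericA 𝕜) (genericB 𝕜) m).symm.trans
    (mk_eq_zero (.zcr m))

variable {F n p a}

/-- The coefficients of the two series are the images of the free generators, so the quotient map
factors through `I`. -/
theorem eq_top_of_coeff_mem (I : LieSubalgebra 𝕜 (FAlgebra F n p a))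
    (hA : ∀ m, seriesA F n p a m ∈ I) (hB : ∀ m, seriesB F n p a m ∈ I) (x : FAlgebra F n p a) :
    x ∈ I := by
  obtain ⟨y, rfl⟩ := mk_surjective F n p a x
  let ψ : FreeLieAlgebra 𝕜 Gen →ₗ⁅𝕜⁆ I := FreeLieAlgebra.lift 𝕜 fun g =>
    match g with
    | .coeffA m => ⟨_, hA m⟩
    | .coeffB m => ⟨_, hB m⟩
  have h : I.incl.comp ψ = mk F n p a := by
    refine FreeLieAlgebra.hom_ext fun g => ?_
    rw [LieHom.comp_apply, FreeLieAlgebra.lift_of_apply]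
    cases g <;> rfl
  rw [← h]
  exact (ψ y).2

/-- The homomorphism of free Lie algebras defined by two series. -/
def freeLift (A B : FormalSeries M) : FreeLieAlgebra 𝕜 Gen →ₗ⁅𝕜⁆ M :=
  FreeLieAlgebra.lift 𝕜 fun g =>
    match g with
    | .coeffA m => A m
    | .coeffB m => B m

theorem freeLift_genericA (A B : FormalSeries M) (m) :
    freeLift (𝕜 := 𝕜) A B (genericA 𝕜 m) = A m := FreeLieAlgebra.lift_of_apply ..

theorem freeLift_genericB (A B : FormalSeries M) (m) :
    freeLift (𝕜 := 𝕜) A B (genericB 𝕜 m) = B m := FreeLieAlgebra.lift_of_apply ..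

theorem exists_lift (A B : FormalSeries M)
    (h : ∀ r, Relation F n p a r → freeLift (𝕜 := 𝕜) A B r = 0) :
    ∃ φ : FAlgebra F n p a →ₗ⁅𝕜⁆ M, ∀ m, φ (seriesA F n p a m) = A m := by
  have hle : LieSubmodule.lieSpan 𝕜 (FreeLieAlgebra 𝕜 Gen) {r | Relation F n p a r}
      ≤ (freeLift (𝕜 := 𝕜) A B).ker :=
    LieSubmodule.lieSpan_le.mpr fun r hr => LieHom.mem_ker.mpr (h r hr)
  let φ : FAlgebra F n p a →ₗ[𝕜] M := Submodule.liftQ _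
    ((freeLift (𝕜 := 𝕜) A B : FreeLieAlgebra 𝕜 Gen →ₗ⁅𝕜⁆ M) : FreeLieAlgebra 𝕜 Gen →ₗ[𝕜] M)
    (fun r hr => LieHom.mem_ker.mp (hle hr))
  have hφ (x) : φ (mk F n p a x) = freeLift (𝕜 := 𝕜) A B x := rfl
  refine ⟨{ φ with map_lie' := ?_ }, fun m => ?_⟩
  · intro x y
    obtain ⟨x, rfl⟩ := mk_surjective F n p a x
    obtain ⟨y, rfl⟩ := mk_surjective F n p a y
    change φ ⁅mk F n p a x, mk F n p a y⁆ = ⁅φ (mk F n p a x), φ (mk F n p a y)⁆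
    rw [← LieHom.map_lie, hφ, hφ, hφ, LieHom.map_lie]
  · exact freeLift_genericA A B m

end FAlgebra

end Universal

section Fordy

variable {𝕜 : Type*} [Field 𝕜] [CharZero 𝕜] {α β : 𝕜} {a : Coord → 𝕜}

open LieSeries

theorem FAlgebra.exists_fordyBasis (h₁ : α + β ≠ 0) (h₂ : 6 * α + β ≠ 0) (h₃ : 16 * α + β ≠ 0) :
    ∃ (P : LieSeries (FAlgebra (fordyRHS α β) 5 0 a)) (K : FAlgebra (fordyRHS α β) 5 0 a),
      LieSeries.mk (seriesA (fordyRHS α β) 5 0 a) = v₀ 𝕜 • P ∧ UFree P ∧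
      FordyBasis α (a (.u 0)) (P.coeff 0) ((pd .x P).coeff 0) ((pd .x (pd .x P)).coeff 0) K ∧
      Submodule.span 𝕜 {P.coeff 0, (pd .x P).coeff 0, (pd .x (pd .x P)).coeff 0, K} = ⊤ := by
  have hZ : FordyZCR α β a (LieSeries.mk (seriesA (fordyRHS α β) 5 0 a))
      (LieSeries.mk (seriesB (fordyRHS α β) 5 0 a)) := by
    rw [← mk_zeroCurvature_eq_zero_iff]
    exact zeroCurvature_series (fordyRHS α β) 5 0 a
  have hA (k : ℕ) (hk : 1 ≤ k) :
      pd (.u k) (LieSeries.mk (seriesA (fordyRHS α β) 5 0 a)) = 0 := by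
    ext m
    have : seriesA (fordyRHS α β) 5 0 a (m + Finsupp.single (.u k) 1) = 0 :=
      mk_eq_zero (.orderA _ fun h => by simpa using h k hk)
    rw [coeff_pd, coeff_mk, this, smul_zero, LieSeries.coeff_zero]
  have hB (k : ℕ) (hk : 5 ≤ k) :
      pd (.u k) (LieSeries.mk (seriesB (fordyRHS α β) 5 0 a)) = 0 := by
    ext m
    have : seriesB (fordyRHS α β) 5 0 a (m + Finsupp.single (.u k) 1) = 0 :=
      mk_eq_zero (.orderB _ fun h => by simpa using h k (by omega))
    rw [coeff_pd, coeff_mk, this, smul_zero, LieSeries.coeff_zero]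
  obtain ⟨P, K, hP, hu, hb, hAI, hBI⟩ := hZ.exists_fordyBasis h₁ h₂ h₃ hA hB
    (fun m hm => mk_eq_zero (.normA m hm)) (fun m hx hm => mk_eq_zero (.normB m hx hm))
  refine ⟨P, K, hP, hu, hb, ?_⟩
  rw [eq_top_iff]
  intro x _
  exact eq_top_of_coeff_mem hb.subalgebra hAI hBI x

end Fordy

end EvolutionEquation

end

/-! ### Construction of a solution by exponentials. -/

noncomputable section

namespace EvolutionEquation

open MvPolynomial LieSeries

section Exponential

variable {𝕜 : Type*} [Field 𝕜] {L : Type*} [LieRing L] [LieAlgebra 𝕜 L]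

/-- A constant series. -/
def constSeries (J : L) : LieSeries L := LieSeries.mk fun m => if m = 0 then J else 0

theorem coeff_constSeries_zero (J : L) : (constSeries J).coeff 0 = J := by
  rw [constSeries, coeff_mk, if_pos rfl]

theorem coeff_constSeries_of_ne (J : L) (m : Coord →₀ ℕ) (hm : m ≠ 0) :
    (constSeries J).coeff m = 0 := if_neg hm

theorem pd_constSeries (J : L) (v : Coord) : pd v (constSeries J) = 0 := by
  ext m
  rw [coeff_pd, coeff_constSeries_of_ne, smul_zero, LieSeries.coeff_zero]
  intro h
  simpa using DFunLike.congr_fun h v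

variable (𝕜) in
open Classical in
/-- The series `exp((t - t_a) ad J) exp((x - x_a) ad w) y`. -/
def expSeries (J w y : L) : LieSeries L := LieSeries.mk fun m =>
  if NoU m then (((m .x).factorial : 𝕜)⁻¹ * ((m .t).factorial : 𝕜)⁻¹) •
    ((LieAlgebra.ad 𝕜 L J ^ m .t) ((LieAlgebra.ad 𝕜 L w ^ m .x) y)) else 0

theorem coeff_expSeries_of_noU (J w y : L) {m : Coord →₀ ℕ} (hm : NoU m) :
    (expSeries 𝕜 J w y).coeff m = (((m .x).factorial : 𝕜)⁻¹ * ((m .t).factorial : 𝕜)⁻¹) •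
      ((LieAlgebra.ad 𝕜 L J ^ m .t) ((LieAlgebra.ad 𝕜 L w ^ m .x) y)) := if_pos hm

theorem coeff_expSeries_of_not_noU (J w y : L) {m : Coord →₀ ℕ} (hm : ¬ NoU m) :
    (expSeries 𝕜 J w y).coeff m = 0 := if_neg hm

theorem coeff_expSeries_zero (J w y : L) : (expSeries 𝕜 J w y).coeff 0 = y := by
  rw [coeff_expSeries_of_noU _ _ _ fun _ => rfl]
  simp

theorem expSeries_add (J w y z : L) :
    expSeries 𝕜 J w (y + z) = expSeries 𝕜 J w y + expSeries 𝕜 J w z := by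
  ext m
  by_cases hm : NoU m
  · simp only [LieSeries.coeff_add, coeff_expSeries_of_noU _ _ _ hm, map_add, smul_add]
  · simp only [LieSeries.coeff_add, coeff_expSeries_of_not_noU _ _ _ hm, add_zero]

theorem expSeries_smul (J w : L) (r : 𝕜) (y : L) :
    expSeries 𝕜 J w (r • y) = r • expSeries 𝕜 J w y := by
  ext m
  by_cases hm : NoU m
  · simp only [LieSeries.coeff_smul, coeff_expSeries_of_noU _ _ _ hm, map_smul]
    exact smul_comm _ _ _
  · simp only [LieSeries.coeff_smul, coeff_expSeries_of_not_noU _ _ _ hm, smul_zero]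

theorem uFree_expSeries (J w y : L) : UFree (expSeries 𝕜 J w y) := fun k => by
  ext m
  rw [coeff_pd, coeff_expSeries_of_not_noU, smul_zero, LieSeries.coeff_zero]
  intro h
  simpa using h k

/-- At `x = x_a` only `exp((t - t_a) ad J) J = J` remains. -/
theorem expSeries_self_sub_mem_initNull (J w : L) :
    expSeries 𝕜 J w J - constSeries J ∈ initNull 𝕜 L := fun m hx hm => by
  rw [LieSeries.coeff_sub, coeff_expSeries_of_noU _ _ _ hm, hx]
  by_cases ht : m .t = 0
  · have h0 : m = 0 := by
      ext v
      cases v with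
      | x => exact hx
      | t => exact ht
      | u k => exact hm k
    rw [h0, coeff_constSeries_zero]
    simp
  · rw [coeff_constSeries_of_ne _ _ (fun h => ht (by rw [h]; rfl))]
    obtain ⟨n, hn⟩ := Nat.exists_eq_succ_of_ne_zero ht
    rw [hn, pow_succ]
    simp

variable [CharZero 𝕜]

theorem pd_x_expSeries (J w y : L) :
    pd .x (expSeries 𝕜 J w y) = expSeries 𝕜 J w ⁅w, y⁆ := by
  ext m
  rw [coeff_pd]
  by_cases hm : NoU m
  · have hm' : NoU (m + Finsupp.single .x 1) := fun k => by simpa using hm k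
    rw [coeff_expSeries_of_noU _ _ _ hm, coeff_expSeries_of_noU _ _ _ hm']
    have h1 : (m + Finsupp.single Coord.x 1 : Coord →₀ ℕ) Coord.x = m .x + 1 := by simp
    have h2 : (m + Finsupp.single Coord.x 1 : Coord →₀ ℕ) Coord.t = m .t := by simp
    rw [h1, h2, ← Nat.cast_smul_eq_nsmul 𝕜, smul_smul, pow_succ (LieAlgebra.ad 𝕜 L w),
      Module.End.mul_apply, LieAlgebra.ad_apply, Nat.factorial_succ]
    congr 1
    have : ((m .x + 1 : ℕ) : 𝕜) ≠ 0 := Nat.cast_ne_zero.mpr (Nat.succ_ne_zero _)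
    push_cast at this ⊢
    field_simp
  · have hm' : ¬ NoU (m + Finsupp.single .x 1) := fun h => hm fun k => by simpa using h k
    rw [coeff_expSeries_of_not_noU _ _ _ hm, coeff_expSeries_of_not_noU _ _ _ hm', smul_zero]

theorem pd_t_expSeries (J w y : L) :
    pd .t (expSeries 𝕜 J w y) = ⁅constSeries J, expSeries 𝕜 J w y⁆ := by
  ext m
  rw [coeff_pd, coeff_const_lie (coeff_constSeries_of_ne J), coeff_constSeries_zero]
  by_cases hm : NoU m
  · have hm' : NoU (m + Finsupp.single .t 1) := fun k => by simpa using hm k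
    rw [coeff_expSeries_of_noU _ _ _ hm, coeff_expSeries_of_noU _ _ _ hm']
    have h1 : (m + Finsupp.single Coord.t 1 : Coord →₀ ℕ) Coord.x = m .x := by simp
    have h2 : (m + Finsupp.single Coord.t 1 : Coord →₀ ℕ) Coord.t = m .t + 1 := by simp
    rw [h1, h2, ← Nat.cast_smul_eq_nsmul 𝕜, smul_smul, pow_succ' (LieAlgebra.ad 𝕜 L J),
      Module.End.mul_apply, LieAlgebra.ad_apply, Nat.factorial_succ, lie_smul]
    congr 1
    have : ((m .t + 1 : ℕ) : 𝕜) ≠ 0 := Nat.cast_ne_zero.mpr (Nat.succ_ne_zero _)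
    push_cast at this ⊢
    field_simp
  · have hm' : ¬ NoU (m + Finsupp.single .t 1) := fun h => hm fun k => by simpa using h k
    rw [coeff_expSeries_of_not_noU _ _ _ hm, coeff_expSeries_of_not_noU _ _ _ hm', smul_zero,
      lie_zero]

theorem coeff_succ_eq (𝕜 : Type*) [Field 𝕜] [CharZero 𝕜] {L : Type*} [LieRing L] [LieAlgebra 𝕜 L]
    {f g f' g' : LieSeries L} {v : Coord} (hf : pd v f = f') (hg : pd v g = g')
    {m : Coord →₀ ℕ} (h : f'.coeff m = g'.coeff m) :
    f.coeff (m + Finsupp.single v 1) = g.coeff (m + Finsupp.single v 1) := by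
  rw [← hf, ← hg, coeff_pd, coeff_pd, ← Nat.cast_smul_eq_nsmul 𝕜, ← Nat.cast_smul_eq_nsmul 𝕜] at h
  exact smul_right_injective L (Nat.cast_ne_zero.mpr (Nat.succ_ne_zero _)) h

/-- Exponentials of derivations respect brackets. On coefficients: both sides have equal value at
the point and satisfy the same differential equations. -/
theorem lie_expSeries (J w y z : L) :
    ⁅expSeries 𝕜 J w y, expSeries 𝕜 J w z⁆ = expSeries 𝕜 J w ⁅y, z⁆ := by
  ext m
  induction m using monomial_induction generalizing y z with
  | h0 => simp [coeff_lie, coeff_expSeries_zero]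
  | h m v ih =>
    cases v with
    | x =>
      refine coeff_succ_eq 𝕜 (pd_lie _ _ _) (pd_x_expSeries _ _ _) ?_
      rw [LieSeries.coeff_add, pd_x_expSeries, pd_x_expSeries, ih, ih, leibniz_lie w y z,
        expSeries_add, LieSeries.coeff_add]
    | t =>
      refine coeff_succ_eq 𝕜 (pd_lie _ _ _) (pd_t_expSeries _ _ _) ?_
      rw [pd_t_expSeries, pd_t_expSeries, ← leibniz_lie,
        coeff_const_lie (coeff_constSeries_of_ne J), coeff_const_lie (coeff_constSeries_of_ne J), ih]
    | u k =>
      refine coeff_succ_eq 𝕜 (pd_lie _ _ _) (uFree_expSeries _ _ _ k) ?_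
      rw [uFree_expSeries (𝕜 := 𝕜), uFree_expSeries (𝕜 := 𝕜), zero_lie, lie_zero, add_zero]

/-- A solution of the zero-curvature equation for Fordy's equation with given initial values. -/
theorem exists_fordyZCR {α : 𝕜} (β : 𝕜) (hα : α ≠ 0) (a : Coord → 𝕜) {e h f : L}
    (hb : FordyBasis α (a (.u 0)) e h f 0) :
    ∃ P B : LieSeries L, FordyZCR α β a (v₀ 𝕜 • P) B ∧ UFree P ∧ (∀ k, 5 ≤ k → pd (.u k) B = 0) ∧
      B ∈ initNull 𝕜 L ∧ P.coeff 0 = e ∧ (pd .x P).coeff 0 = h ∧ (pd .x (pd .x P)).coeff 0 = f := by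
  obtain ⟨heh, hef, hhf, -, -, -⟩ := hb
  set s := a (.u 0) with hs
  rw [zero_sub] at heh hhf
  set c₀ := 6 * a (.u 4) + 6 * a (.u 2) * (8 * α - 2 * β) * s - 12 * β * a (.u 1) ^ 2 with hc₀
  set c₁ := 12 * β * s * a (.u 1) - 6 * a (.u 3) with hc₁
  set c₂ := 6 * a (.u 2) with hc₂
  -- The value forced by the normalization of `B`: it makes `explicitB + 6b` vanish at `x = x_a`,
  -- `u_k = a_k`.
  set J : L := (6⁻¹ : 𝕜) • (c₀ • e + c₁ • h + c₂ • f) + (-β * s ^ 2) • (f + (8 * α * s) • e) with hJ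
  -- Chosen so that `ad w` acts on `e, h, f` as `∂_x` must act on `P, P_x, P_xx`; this is where `α ≠
  -- 0` is needed.
  set w : L := ((4 * α)⁻¹ : 𝕜) • (f + (8 * α * s) • e) with hw
  have hwe : ⁅w, e⁆ = h := by
    rw [hw, smul_lie, add_lie, smul_lie, lie_self, ← lie_skew, hef]
    match_scalars
    field_simp
  have hwh : ⁅w, h⁆ = f := by
    rw [hw, smul_lie, add_lie, smul_lie, heh, ← lie_skew, hhf]
    match_scalars <;> field_simp
    ring
  have hwf : ⁅w, f⁆ = (-8 * α * s) • h := by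
    rw [hw, smul_lie, add_lie, smul_lie, lie_self, hef]
    match_scalars
    field_simp
  set S := expSeries 𝕜 J w with hS
  have Slie (y z : L) : ⁅S y, S z⁆ = S ⁅y, z⁆ := lie_expSeries J w y z
  have Ssmul (r : 𝕜) (y : L) : S (r • y) = r • S y := expSeries_smul J w r y
  have Sadd (y z : L) : S (y + z) = S y + S z := expSeries_add J w y z
  have Sx (y : L) : pd .x (S y) = S ⁅w, y⁆ := pd_x_expSeries J w y
  have hP₁ : pd .x (S e) = S h := by rw [Sx, hwe]
  have hP₂ : pd .x (S h) = S f := by rw [Sx, hwh]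
  have hP₃ : pd .x (S f) = (-8 * α * s) • S h := by rw [Sx, hwf, Ssmul]
  have hP : UFree (S e) := uFree_expSeries J w e
  set b : LieSeries L := (-β * s ^ 2) • S (f + (8 * α * s) • e) - constSeries J with hb
  have ub : UFree b := ((uFree_expSeries J w _).smul _).sub fun k => pd_constSeries J _
  have hef' : ⁅S e, S f⁆ = (-4 * α) • S h := by rw [Slie, hef, Ssmul]
  have heh' : ⁅S e, S h⁆ = -((4 * α) • S e) := by
    rw [Slie, heh, ← neg_smul, Ssmul, neg_smul]
  have hb6 (y : LieSeries L) : (6 : MvPolynomial Coord 𝕜) • (C 6⁻¹ : MvPolynomial Coord 𝕜) • y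
      = y := by
    rw [← map_ofNat C, smul_smul, ← C_mul]
    simp
  set B : LieSeries L := (C 6⁻¹ : MvPolynomial Coord 𝕜) •
    (explicitB α β a (S e) + (6 : MvPolynomial Coord 𝕜) • b) with hB
  refine ⟨S e, B, ?_, hP, ?_, ?_, coeff_expSeries_zero _ _ _, ?_, ?_⟩
  · rw [fordyZCR_iff hP ub _ _ (hb6 _)]
    · simp only [hP₁, hP₂, hP₃, pd_smul, lie_smul, hef', ← hs]
      refine ⟨?_, ?_, ?_⟩
      · rw [hb, map_sub, pd_smul, pd_constSeries, Sadd, Ssmul, map_add, pd_smul, hP₁, hP₃]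
        module
      · rw [hb, hS, pd_t_expSeries, ← hS, sub_lie, smul_lie, Sadd, Ssmul, add_lie, smul_lie,
          lie_self, ← lie_skew (S f), hef']
        module
      · rw [lie_self]
        module
    · rw [hP₁, hP₂, hef', C_smul]
    · rw [hP₁, heh', lie_neg, lie_smul, lie_self, smul_zero, neg_zero]
  · intro k hk
    have h6b : pd (.u k) ((6 : MvPolynomial Coord 𝕜) • b) = 0 := by
      rw [← map_ofNat C]; exact ub.C_smul _ k
    rw [hB, pd_poly_smul, pderiv_C, zero_smul, zero_add, map_add, h6b, pd_explicitB_succ hP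
      (by omega), if_neg (by omega), if_neg (by omega), if_neg (by omega), if_neg (by omega)]
    simp
  · refine Submodule.smul_mem _ _ ?_
    have h1 := explicitB_sub_mem_initNull α β a (S e)
      (by rw [hP₁, hP₂, hP₃])
    have h2 : (6 : MvPolynomial Coord 𝕜) • (S J - constSeries J) ∈ initNull 𝕜 L :=
      Submodule.smul_mem _ _ (expSeries_self_sub_mem_initNull (𝕜 := 𝕜) J w)
    have h3 := add_mem h1 h2
    convert h3 using 1
    have h6 (y : LieSeries L) : (6 : MvPolynomial Coord 𝕜) • y = (6 : 𝕜) • y := by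
      rw [← C_smul, map_ofNat]
    have hSJ : (6 : 𝕜) • S J = c₀ • S e + c₁ • S h + c₂ • S f
        + (-6 * β * s ^ 2) • S (f + (8 * α * s) • e) := by
      rw [hJ, Sadd, Ssmul, Ssmul, Sadd, Sadd, Ssmul, Ssmul, Ssmul]
      module
    rw [h6, h6, ← hs, ← hc₀, ← hc₁, ← hc₂, hP₁, hP₂, heh', smul_sub (6 : 𝕜) (S J), hSJ, hb]
    module
  · rw [hP₁]; exact coeff_expSeries_zero _ _ _
  · rw [hP₁, hP₂]; exact coeff_expSeries_zero _ _ _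

end Exponential

end EvolutionEquation

end

/-! ### Structure of the spanned algebra: the nilpotent case and the splitting. -/

noncomputable section

namespace EvolutionEquation

open MvPolynomial LieSeries LieAlgebra.SpecialLinear

section Nilpotent

variable {𝕜 : Type*} [Field 𝕜] {L : Type*} [LieRing L] [LieAlgebra 𝕜 L]
  {α s : 𝕜} {p₀ p₁ p₂ K : L}

theorem exists_coordinates (ht : Submodule.span 𝕜 {p₀, p₁, p₂, K} = ⊤) (x : L) :
    ∃ c₀ c₁ c₂ c₃ : 𝕜, x = c₀ • p₀ + c₁ • p₁ + c₂ • p₂ + c₃ • K := by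
  have hx : x ∈ Submodule.span 𝕜 {p₀, p₁, p₂, K} := ht ▸ Submodule.mem_top
  simp only [Submodule.mem_span_insert, Submodule.mem_span_singleton] at hx
  obtain ⟨c₀, _, ⟨c₁, _, ⟨c₂, _, ⟨c₃, rfl⟩, rfl⟩, rfl⟩, rfl⟩ := hx
  exact ⟨c₀, c₁, c₂, c₃, by abel⟩

theorem finite_of_span_eq_top (ht : Submodule.span 𝕜 {p₀, p₁, p₂, K} = ⊤) :
    Module.Finite 𝕜 L := by
  rw [Module.finite_def, ← ht]
  exact Submodule.fg_span (by simp)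

theorem finrank_le_of_span_eq_top (ht : Submodule.span 𝕜 {p₀, p₁, p₂, K} = ⊤) :
    Module.finrank 𝕜 L ≤ 4 := by
  have h := finrank_range_le_card (R := 𝕜) ![p₀, p₁, p₂, K]
  have hr : Set.range ![p₀, p₁, p₂, K] = {p₀, p₁, p₂, K} := by
    simp only [Matrix.range_cons, Matrix.range_empty, Set.union_empty]
    rfl
  rw [Set.finrank, hr, ht, finrank_top] at h
  simpa using h

namespace FordyBasis

theorem mem_center (h : FordyBasis α s p₀ p₁ p₂ K)
    (ht : Submodule.span 𝕜 {p₀, p₁, p₂, K} = ⊤) : K ∈ LieAlgebra.center 𝕜 L := by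
  rw [LieModule.mem_maxTrivSubmodule]
  intro x
  obtain ⟨c₀, c₁, c₂, c₃, rfl⟩ := exists_coordinates ht x
  simp [h.lie₀, h.lie₁, h.lie₂]

/-- For `α = 0` all brackets are multiples of the central element `K`, so the quotient by the centre
is abelian. -/
theorem isNilpotent (h : FordyBasis (0 : 𝕜) s p₀ p₁ p₂ K)
    (ht : Submodule.span 𝕜 {p₀, p₁, p₂, K} = ⊤) : LieRing.IsNilpotent L := by
  have hK := h.mem_center ht
  have h₀₁ := h.lie₀₁
  have h₀₂ := h.lie₀₂
  have h₁₂ := h.lie₁₂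
  simp only [mul_zero, zero_mul, zero_smul, sub_zero, add_zero] at h₀₁ h₀₂ h₁₂
  have key (x y : L) : ⁅x, y⁆ ∈ LieAlgebra.center 𝕜 L := by
    obtain ⟨c₀, c₁, c₂, c₃, rfl⟩ := exists_coordinates ht x
    obtain ⟨d₀, d₁, d₂, d₃, rfl⟩ := exists_coordinates ht y
    have e : ⁅c₀ • p₀ + c₁ • p₁ + c₂ • p₂ + c₃ • K, d₀ • p₀ + d₁ • p₁ + d₂ • p₂ + d₃ • K⁆
        = (c₀ * d₁ - c₁ * d₀) • K := by
      have s₀₁ : ⁅p₁, p₀⁆ = -K := by rw [← lie_skew, h₀₁]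
      have s₀₂ : ⁅p₂, p₀⁆ = 0 := by rw [← lie_skew, h₀₂, neg_zero]
      have s₁₂ : ⁅p₂, p₁⁆ = 0 := by rw [← lie_skew, h₁₂, neg_zero]
      have s₀ : ⁅K, p₀⁆ = 0 := by rw [← lie_skew, h.lie₀, neg_zero]
      have s₁ : ⁅K, p₁⁆ = 0 := by rw [← lie_skew, h.lie₁, neg_zero]
      have s₂ : ⁅K, p₂⁆ = 0 := by rw [← lie_skew, h.lie₂, neg_zero]
      simp only [lie_add, add_lie, lie_smul, smul_lie, lie_self, h₀₁, h₀₂, h₁₂, h.lie₀, h.lie₁,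
        h.lie₂, s₀₁, s₀₂, s₁₂, s₀, s₁, s₂]
      module
    rw [e]
    exact (LieAlgebra.center 𝕜 L).smul_mem _ hK
  refine LieAlgebra.nilpotent_of_nilpotent_quotient (le_refl (LieAlgebra.center 𝕜 L)) ?_
  have : IsLieAbelian (L ⧸ LieAlgebra.center 𝕜 L) := ⟨fun x y => by
    obtain ⟨x, rfl⟩ := LieSubmodule.Quotient.surjective_mk' _ x
    obtain ⟨y, rfl⟩ := LieSubmodule.Quotient.surjective_mk' _ y
    exact (LieSubmodule.Quotient.mk_bracket _ x y).symm.trans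
      (LieSubmodule.Quotient.mk_eq_zero'.mpr (key x y))⟩
  infer_instance

end FordyBasis

end Nilpotent

section SpecialLinear

variable {𝕜 : Type*} [Field 𝕜] {L : Type*} [LieRing L] [LieAlgebra 𝕜 L]

theorem sl_apply_one_one (X : sl (Fin 2) 𝕜) : X.1 1 1 = -X.1 0 0 := by
  have h : X.1.trace = 0 := X.2
  rw [Matrix.trace_fin_two] at h
  linear_combination h

/-- The homomorphism from `𝔰𝔩₂` defined by a triple with the relations of the standard basis. -/
def slHom (E F H : L) (h₁ : ⁅E, F⁆ = H) (h₂ : ⁅H, E⁆ = (2 : 𝕜) • E)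
    (h₃ : ⁅H, F⁆ = (-2 : 𝕜) • F) : sl (Fin 2) 𝕜 →ₗ⁅𝕜⁆ L where
  toFun X := X.1 0 1 • E + X.1 1 0 • F + X.1 0 0 • H
  map_add' X Y := by
    have h : (X + Y).1 = X.1 + Y.1 := rfl
    simp only [h, Matrix.add_apply]
    module
  map_smul' r X := by
    have h : (r • X).1 = r • X.1 := rfl
    simp only [h, Matrix.smul_apply, RingHom.id_apply, smul_eq_mul]
    module
  map_lie' {X Y} := by
    have s₁ : ⁅F, E⁆ = -H := by rw [← lie_skew, h₁]
    have s₂ : ⁅E, H⁆ = (-2 : 𝕜) • E := by rw [← lie_skew, h₂]; module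
    have s₃ : ⁅F, H⁆ = (2 : 𝕜) • F := by rw [← lie_skew, h₃]; module
    simp only [sl_bracket, Matrix.sub_apply, Matrix.mul_apply, Fin.sum_univ_two,
      sl_apply_one_one, lie_add, add_lie, lie_smul, smul_lie, lie_self, h₁, h₂, h₃, s₁, s₂, s₃]
    module

/-- The element of `𝔰𝔩₂` with given entries. -/
def slMk (p q r : 𝕜) : sl (Fin 2) 𝕜 :=
  ⟨!![p, q; r, -p], by
    change Matrix.trace (!![p, q; r, -p] : Matrix (Fin 2) (Fin 2) 𝕜) = 0
    simp [Matrix.trace_fin_two]⟩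

/-- The model with `K = 0`. For `α ≠ 0` these three matrices form a basis of `𝔰𝔩₂`. -/
theorem fordyBasis_sl (α s : 𝕜) :
    FordyBasis α s (slMk 0 1 0) (slMk (2 * α) 0 0) (slMk 0 (-4 * α * s) (-8 * α ^ 2)) 0 := by
  refine ⟨?_, ?_, ?_, lie_zero _, lie_zero _, lie_zero _⟩ <;>
  · apply Subtype.ext
    rw [sl_bracket]
    ext i j
    fin_cases i <;> fin_cases j <;>
      simp [slMk] <;> ring

theorem sl_eq_zero_of_lie [CharZero 𝕜] (X : sl (Fin 2) 𝕜) (h : ∀ Y : sl (Fin 2) 𝕜, ⁅Y, X⁆ = 0) :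
    X = 0 := by
  have h₁ := congrArg Subtype.val (h (slMk 0 1 0))
  have h₂ := congrArg Subtype.val (h (slMk 0 0 1))
  rw [sl_bracket] at h₁ h₂
  have e₁ := congrFun (congrFun h₁ 0) 0
  have e₂ := congrFun (congrFun h₁ 0) 1
  have e₃ := congrFun (congrFun h₂ 0) 0
  simp only [Matrix.sub_apply, Matrix.mul_apply, Fin.sum_univ_two, sl_apply_one_one] at e₁ e₂ e₃
  simp [slMk] at e₁ e₂ e₃
  have e₄ : X.1 0 0 = 0 := by
    have : (2 : 𝕜) * X.1 0 0 = 0 := by linear_combination -e₂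
    exact (mul_eq_zero.mp this).resolve_left two_ne_zero
  apply Subtype.ext
  ext i j
  fin_cases i <;> fin_cases j <;> simp [sl_apply_one_one, e₁, e₃, e₄]

end SpecialLinear

section Splitting

variable {𝕜 : Type*} [Field 𝕜] [CharZero 𝕜] {L : Type u} [LieRing L] [LieAlgebra 𝕜 L]
  {α s : 𝕜} {p₀ p₁ p₂ K : L}

/-- A Lie algebra spanned by a Fordy basis with a suitable homomorphism to `𝔰𝔩₂` is the direct sum
of `𝔰𝔩₂` and its centre. -/
theorem FordyBasis.exists_equiv (hα : α ≠ 0) (h : FordyBasis α s p₀ p₁ p₂ K)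
    (ht : Submodule.span 𝕜 {p₀, p₁, p₂, K} = ⊤) (φ : L →ₗ⁅𝕜⁆ sl (Fin 2) 𝕜)
    (hφ₀ : φ p₀ = slMk 0 1 0) (hφ₁ : φ p₁ = slMk (2 * α) 0 0)
    (hφ₂ : φ p₂ = slMk 0 (-4 * α * s) (-8 * α ^ 2)) :
    ∃ (V : Type u) (_ : LieRing V) (_ : LieAlgebra 𝕜 V),
      IsLieAbelian V ∧ Module.Finite 𝕜 V ∧ Module.finrank 𝕜 V ≤ 1 ∧
      Nonempty (L ≃ₗ⁅𝕜⁆ (sl (Fin 2) 𝕜 × V)) := by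
  have hK := h.mem_center ht
  have hK' (x : L) : ⁅x, K⁆ = 0 := hK x
  have hK'' (x : L) : ⁅K, x⁆ = 0 := by rw [← lie_skew, hK', neg_zero]
  have hsl := fordyBasis_sl α s
  have hφK : φ K = 0 := by
    have h1 : K = ⁅p₀, p₁⁆ + (4 * α) • p₀ := by rw [h.lie₀₁]; abel
    rw [h1, map_add, LieHom.map_lie, map_smul, hφ₀, hφ₁, hsl.lie₀₁]
    module
  -- the section of `φ`
  set E : L := p₀ - (4 * α)⁻¹ • K with hE
  set H : L := (2 * α)⁻¹ • p₁ with hH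
  set F : L := -(8 * α ^ 2)⁻¹ • (p₂ + (4 * α * s) • E) with hF
  have lEp₁ : ⁅E, p₁⁆ = (-4 * α) • E := by
    rw [hE, sub_lie, smul_lie, hK'', h.lie₀₁]
    match_scalars <;> field_simp
  have lEp₂ : ⁅E, p₂⁆ = (-4 * α) • p₁ := by
    rw [hE, sub_lie, smul_lie, hK'', h.lie₀₂]
    module
  have lp₁p₂ : ⁅p₁, p₂⁆ = (-4 * α) • p₂ - (32 * α ^ 2 * s) • E := by
    rw [h.lie₁₂, hE]
    match_scalars <;> field_simp <;> ring
  have hEF : ⁅E, F⁆ = H := by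
    rw [hF, lie_smul, lie_add, lie_smul, lie_self, lEp₂, hH]
    match_scalars
    field_simp
    norm_num
  have hHE : ⁅H, E⁆ = (2 : 𝕜) • E := by
    rw [hH, smul_lie, ← lie_skew, lEp₁, ← neg_smul, smul_smul]
    congr 1
    field_simp
    norm_num
  have hHF : ⁅H, F⁆ = (-2 : 𝕜) • F := by
    rw [hF, lie_smul, lie_add, lie_smul, hHE, hH, smul_lie, lp₁p₂]
    match_scalars <;> field_simp <;> ring
  set σ := slHom E F H hEF hHE hHF with hσ
  have hσX (X : sl (Fin 2) 𝕜) : σ X = X.1 0 1 • E + X.1 1 0 • F + X.1 0 0 • H := rfl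
  have hφσ (X : sl (Fin 2) 𝕜) : φ (σ X) = X := by
    rw [hσX, hF, hH, hE]
    simp only [map_add, map_smul, map_sub, hφ₀, hφ₁, hφ₂, hφK]
    apply Subtype.ext
    ext i j
    fin_cases i <;> fin_cases j <;> simp [slMk, sl_apply_one_one] <;> field_simp
  have hdec (x : L) : ∃ (X : sl (Fin 2) 𝕜) (c : 𝕜), x = σ X + c • K := by
    obtain ⟨c₀, c₁, c₂, c₃, rfl⟩ := exists_coordinates ht x
    refine ⟨slMk (2 * α * c₁) (c₀ - 4 * α * s * c₂) (-8 * α ^ 2 * c₂), c₃ + (4 * α)⁻¹ * c₀, ?_⟩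
    rw [hσX, hF, hH, hE]
    simp only [slMk, Matrix.of_apply, Matrix.cons_val', Matrix.cons_val_zero,
      Matrix.cons_val_one, Matrix.cons_val_fin_one]
    match_scalars <;> field_simp <;> ring
  -- `φ` is surjective, with section `σ`, so it maps the centre into the centre of `𝔰𝔩₂`, which is
  -- zero. With `hdec`, the centre consists of the multiples of `K`.
  have hcenter (v : L) (hv : v ∈ LieAlgebra.center 𝕜 L) : φ v = 0 := by
    refine sl_eq_zero_of_lie _ fun Y => ?_
    rw [← hφσ Y, ← LieHom.map_lie, hv (σ Y), map_zero]
  have hmul (v : L) (hv : v ∈ LieAlgebra.center 𝕜 L) : ∃ c : 𝕜, c • K = v := by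
    obtain ⟨X, c, rfl⟩ := hdec v
    have h1 := hcenter _ hv
    rw [map_add, map_smul, hφσ, hφK, smul_zero, add_zero] at h1
    exact ⟨c, by rw [h1, map_zero, zero_add]⟩
  have hfin := finite_of_span_eq_top ht
  refine ⟨LieAlgebra.center 𝕜 L, inferInstance, inferInstance, inferInstance, ?_, ?_, ?_⟩
  · exact Module.Finite.of_injective (LieAlgebra.center 𝕜 L).toSubmodule.subtype
      Subtype.val_injective
  · refine finrank_le_one ⟨K, hK⟩ fun v => ?_
    obtain ⟨c, hc⟩ := hmul v.1 v.2
    exact ⟨c, Subtype.ext hc⟩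
  · let Φ : (sl (Fin 2) 𝕜 × LieAlgebra.center 𝕜 L) →ₗ⁅𝕜⁆ L :=
      { toFun := fun p => σ p.1 + p.2.1
        map_add' := fun p q => by
          rw [Prod.fst_add, Prod.snd_add, map_add, LieSubmodule.coe_add]; abel
        map_smul' := fun r p => by
          rw [Prod.smul_fst, Prod.smul_snd, map_smul, LieSubmodule.coe_smul, smul_add]; rfl
        map_lie' := fun {p q} => by
          have e1 (x : L) : ⁅x, (q.2 : L)⁆ = 0 := q.2.2 x
          have e2 (x : L) : ⁅(p.2 : L), x⁆ = 0 := by rw [← lie_skew]; simp [p.2.2 x]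
          have e3 : ⁅p.2, q.2⁆ = 0 := Subtype.ext (e1 p.2)
          rw [LieAlgebra.Prod.bracket_apply, e3]
          simp [e1, e2] }
    have hΦ (p) : Φ p = σ p.1 + p.2.1 := rfl
    refine ⟨(LieEquiv.ofBijective Φ ⟨?_, ?_⟩).symm⟩
    · rw [injective_iff_map_eq_zero]
      rintro ⟨X, v⟩ hXv
      rw [hΦ] at hXv
      have h1 := congrArg φ hXv
      rw [map_add, hφσ, hcenter _ v.2, add_zero, map_zero] at h1
      change X = 0 at h1
      subst h1
      rw [map_zero, zero_add] at hXv
      exact Prod.ext rfl (Subtype.ext hXv)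
    · intro x
      obtain ⟨X, c, rfl⟩ := hdec x
      exact ⟨(X, c • ⟨K, hK⟩), rfl⟩

end Splitting

end EvolutionEquation

end

/-! ### The homomorphism onto `𝔰𝔩₂`, and the conclusion. -/

noncomputable section

namespace EvolutionEquation

open MvPolynomial LieSeries

section Fordy

variable {𝕜 : Type*} [Field 𝕜]

theorem UFree.pd_v₀_smul {L : Type*} [LieRing L] [LieAlgebra 𝕜 L] {P : LieSeries L}
    (hP : UFree P) (k : ℕ) : LieSeries.pd (.u k) (v₀ 𝕜 • P) = if k = 0 then P else 0 := by
  rw [pd_poly_smul, hP, smul_zero, add_zero, pderiv_X]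
  by_cases hk : k = 0
  · subst hk; simp
  · simp [hk, Ne.symm hk]

variable [CharZero 𝕜]

/-- The homomorphism from `𝔽⁰(E, a)` defined by a normalized solution of the zero-curvature
equation. -/
theorem FAlgebra.exists_lift_of_fordyZCR {M : Type*} [LieRing M] [LieAlgebra 𝕜 M] {α β : 𝕜}
    {a : Coord → 𝕜} {P B : LieSeries M} (hP : UFree P) (hB : ∀ k, 5 ≤ k → pd (.u k) B = 0)
    (hB0 : B ∈ initNull 𝕜 M) (hZ : FordyZCR α β a (v₀ 𝕜 • P) B) :
    ∃ φ : FAlgebra (fordyRHS α β) 5 0 a →ₗ⁅𝕜⁆ M,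
      ∀ m, φ (seriesA (fordyRHS α β) 5 0 a m) = (v₀ 𝕜 • P).coeff m := by
  have hA (k : ℕ) (hk : 1 ≤ k) : pd (.u k) (v₀ 𝕜 • P) = 0 := by
    rw [hP.pd_v₀_smul, if_neg (by omega)]
  refine exists_lift (v₀ 𝕜 • P).coeff B.coeff fun r hr => ?_
  cases hr with
  | orderA m hm =>
    rw [freeLift_genericA]
    simp only [DependsUpTo, not_forall] at hm
    obtain ⟨k, hk, hm⟩ := hm
    exact coeff_eq_zero_of_pd_eq_zero 𝕜 (hA k hk) hm
  | orderB m hm =>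
    rw [freeLift_genericB]
    simp only [DependsUpTo, not_forall] at hm
    obtain ⟨k, hk, hm⟩ := hm
    exact coeff_eq_zero_of_pd_eq_zero 𝕜 (hB k hk) hm
  | normA m hm =>
    rw [freeLift_genericA]
    exact coeff_X_smul_of_eq_zero (hm 0) P
  | normA' m hm =>
    rw [freeLift_genericA]
    obtain ⟨k, hk, hm, -⟩ := hm
    exact coeff_eq_zero_of_pd_eq_zero 𝕜 (hA k hk) (by rw [hm]; exact one_ne_zero)
  | normB m hx hm =>
    rw [freeLift_genericB]
    exact hB0 m hx hm
  | zcr m =>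
    rw [map_zeroCurvature]
    simp only [freeLift_genericA, freeLift_genericB]
    exact congrFun (mk_zeroCurvature_eq_zero_iff.mpr hZ) m

/-- The homomorphism from `𝔽⁰(E, a)` to `𝔰𝔩₂`. -/
theorem FAlgebra.exists_hom_sl {α : 𝕜} (β : 𝕜) (hα : α ≠ 0) (a : Coord → 𝕜)
    {P : LieSeries (FAlgebra (fordyRHS α β) 5 0 a)} (hP : UFree P)
    (hA : LieSeries.mk (seriesA (fordyRHS α β) 5 0 a) = v₀ 𝕜 • P) :
    ∃ φ : FAlgebra (fordyRHS α β) 5 0 a →ₗ⁅𝕜⁆ LieAlgebra.SpecialLinear.sl (Fin 2) 𝕜,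
      φ (P.coeff 0) = slMk 0 1 0 ∧ φ ((pd .x P).coeff 0) = slMk (2 * α) 0 0 ∧
      φ ((pd .x (pd .x P)).coeff 0) = slMk 0 (-4 * α * a (.u 0)) (-8 * α ^ 2) := by
  obtain ⟨Q, B, hZ, hQ, hB, hB0, h₀, h₁, h₂⟩ :=
    exists_fordyZCR β hα a (fordyBasis_sl α (a (.u 0)))
  obtain ⟨φ, hφ⟩ := exists_lift_of_fordyZCR hQ hB hB0 hZ
  have hφA (m) : φ ((v₀ 𝕜 • P).coeff m) = (v₀ 𝕜 • Q).coeff m := by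
    rw [← hA]; exact hφ m
  have hpd {f : LieSeries (FAlgebra (fordyRHS α β) 5 0 a)} {g} (v : Coord)
      (h : ∀ m, φ (f.coeff m) = g.coeff m) (m) : φ ((pd v f).coeff m) = (pd v g).coeff m := by
    rw [coeff_pd, coeff_pd, map_nsmul, h]
  -- `P` and `Q` are recovered as the `u_0`-derivatives of the two series `A`, and `φ` commutes with
  -- differentiation of coefficients.
  have hφP (m) : φ (P.coeff m) = Q.coeff m := by
    have h := hpd (.u 0) hφA m
    rwa [hP.pd_v₀_smul, hQ.pd_v₀_smul, if_pos rfl, if_pos rfl] at h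
  exact ⟨φ, (hφP 0).trans h₀, (hpd .x hφP 0).trans h₁, (hpd .x (hpd .x hφP) 0).trans h₂⟩

end Fordy

end EvolutionEquation

end

theorem mainTheorem6 {𝕜 : Type u} [RCLike 𝕜] (α β : 𝕜) (a : EvolutionEquation.Coord → 𝕜) :
    (α + β ≠ 0 → 6 * α + β ≠ 0 → 16 * α + β ≠ 0 → α ≠ 0 →
      ∃ (V : Type u) (_ : LieRing V) (_ : LieAlgebra 𝕜 V),
        IsLieAbelian V ∧ Module.Finite 𝕜 V ∧ Module.finrank 𝕜 V ≤ 3 ∧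
        Nonempty (EvolutionEquation.FAlgebra (EvolutionEquation.fordyRHS α β) 5 0 a ≃ₗ⁅𝕜⁆
          (LieAlgebra.SpecialLinear.sl (Fin 2) 𝕜 × V))) ∧
    (α = 0 → β ≠ 0 →
      LieRing.IsNilpotent (EvolutionEquation.FAlgebra (EvolutionEquation.fordyRHS α β) 5 0 a) ∧
      Module.Finite 𝕜 (EvolutionEquation.FAlgebra (EvolutionEquation.fordyRHS α β) 5 0 a) ∧
      Module.finrank 𝕜
        (EvolutionEquation.FAlgebra (EvolutionEquation.fordyRHS α β) 5 0 a) ≤ 6) := by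
  refine ⟨fun h₁ h₂ h₃ hα => ?_, ?_⟩
  · obtain ⟨P, K, hA, hP, hb, ht⟩ :=
      EvolutionEquation.FAlgebra.exists_fordyBasis (a := a) h₁ h₂ h₃
    obtain ⟨φ, hφ₀, hφ₁, hφ₂⟩ := EvolutionEquation.FAlgebra.exists_hom_sl β hα a hP hA
    obtain ⟨V, _, _, h, hf, hr, he⟩ := hb.exists_equiv hα ht φ hφ₀ hφ₁ hφ₂
    -- The abelian summand found has dimension at most 1.
    exact ⟨V, _, _, h, hf, hr.trans (by norm_num), he⟩
  · rintro rfl hβ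
    -- For `α = 0` the three nonvanishing conditions all reduce to `β ≠ 0`; the dimension obtained
    -- is at most 4.
    obtain ⟨P, K, -, -, hb, ht⟩ :=
      EvolutionEquation.FAlgebra.exists_fordyBasis (a := a) (α := (0 : 𝕜)) (β := β)
        (by simpa using hβ) (by simpa using hβ) (by simpa using hβ)
    exact ⟨hb.isNilpotent ht, EvolutionEquation.finite_of_span_eq_top ht,
      (EvolutionEquation.finrank_le_of_span_eq_top ht).trans (by norm_num)⟩
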